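/- Let $\pi$ be a probability distribution on $\mathbb{R}$ with measurable Lebesgue density $\pi(x)$, let $G^{-1}:\mathbb{R}\to(0,\infty)$ be measurable and let $h>0$. Assume that $\pi(x)$ and $G^{-1}(x)$ are bounded away from $0$ and $\infty$ on compact sets. Consider the Metropolis--Hastings chain with proposal $Q(x,\cdot)=\mathcal{N}(x,hG^{-1}(x))$ with density $q(\cdot\,|\,x)$, that is, with transition kernel $P(x,dy)=\alpha(x,y)Q(x,dy)+r(x)\delta_x(dy)$, where $\alpha(x,y)=1\wedge\frac{\pi(y)q(x|y)}{\pi(x)q(y|x)}$ and $r(x)=1-\int\alpha(x,y)Q(x,dy)$ (the position-dependent random walk Metropolis chain, PDRWM). It is called geometrically ergodic if there are $\rho\in[0,1)$ and $M:\mathbb{R}\to(0,\infty)$ such that, for $\pi$-almost every $x$ and all $n\ge 0$, $\sup_A|P^n(x,A)-\pi(A)|\le M(x)\rho^n$, the supremum being over Borel sets $A$. (1) Suppose that $\pi$ is log-concave in the tails: for some $x_0>0$, $a>0$ one has $\pi(y)/\pi(x)\le e^{-a(|y|-|x|)}$ whenever $y\ge x\ge x_0$ or $y\le x\le -x_0$.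 Suppose that $G^{-1}(x)=o(|x|^2)$ as $|x|\to\infty$, that $\liminf_{|x|\to\infty}G^{-1}(x)>0$, and that $G^{-1}$ does not oscillate in the tails: $G^{-1}(y)/G^{-1}(x)\to1$ as $|x|\to\infty$ and $y/x\to1$ (this holds for instance if $G^{-1}(x)/|x|^{\gamma}$ has a limit in $(0,\infty)$ for some $\gamma\ge0$). Then the PDRWM chain is geometrically ergodic. (2) Let $\beta\in(0,1)$ and suppose that $\pi$ is subexponential with exponent $\beta$: for some $x_0>0$, $a>0$ one has $\pi(y)/\pi(x)\le \exp\{-a(|y|^\beta-|x|^\beta)\}$ whenever $y\ge x\ge x_0$ or $y\le x\le -x_0$. If $G^{-1}(x)=\Theta(|x|^\gamma)$ for some $\gamma$ with $2(1-\beta)<\gamma<2$, meaning that $G^{-1}(x)/|x|^\gamma\to C$ as $|x|\to\infty$ for some $C\in(0,\infty)$, then the PDRWM chain is geometrically ergodic. -/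

import Mathlib

open MeasureTheory ProbabilityTheory Filter Topology Asymptotics
open scoped ENNReal NNReal

noncomputable section

namespace PDRWM

/-- The target distribution `π(dx) = p(x) dx` with Lebesgue density `p`. -/
def target (p : ℝ → ℝ) : Measure ℝ :=
  volume.withDensity (fun x => ENNReal.ofReal (p x))

/-- `f` is bounded away from `0` and `∞` on compact sets. -/
def BoundedAwayOnCompacts (f : ℝ → ℝ) : Prop :=
  ∀ K : Set ℝ, IsCompact K → ∃ m M : ℝ, 0 < m ∧ ∀ x ∈ K, m ≤ f x ∧ f x ≤ M

/-- The variance `h G⁻¹(x)` of the proposal made from `x`. -/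
def propVar (Ginv : ℝ → ℝ) (h x : ℝ) : ℝ≥0 := (h * Ginv x).toNNReal

/-- The proposal density `q(y | x)`, that of `N(x, h G⁻¹(x))`. -/
def propDensity (Ginv : ℝ → ℝ) (h x y : ℝ) : ℝ := gaussianPDFReal x (propVar Ginv h x) y

/-- The proposal distribution `Q(x, ·) = N(x, h G⁻¹(x))`. -/
def proposal (Ginv : ℝ → ℝ) (h x : ℝ) : Measure ℝ := gaussianReal x (propVar Ginv h x)

/-- The Metropolis-Hastings acceptance rate
`α(x, y) = 1 ∧ π(y) q(x | y) / (π(x) q(y | x))`. -/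
def accept (p Ginv : ℝ → ℝ) (h x y : ℝ) : ℝ :=
  min 1 (p y * propDensity Ginv h y x / (p x * propDensity Ginv h x y))

/-- The probability `r(x) = 1 - ∫ α(x, y) Q(x, dy)` of staying at `x` through rejection. -/
def rejectProb (p Ginv : ℝ → ℝ) (h x : ℝ) : ℝ≥0∞ :=
  1 - ∫⁻ y, ENNReal.ofReal (accept p Ginv h x y) ∂(proposal Ginv h x)

theorem measurable_propVar {Ginv : ℝ → ℝ} (h : ℝ) (hG : Measurable Ginv) :
    Measurable (propVar Ginv h) :=
  (hG.const_mul h).real_toNNReal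

theorem measurable_propDensity {Ginv : ℝ → ℝ} (h : ℝ) (hG : Measurable Ginv) :
    Measurable (fun z : ℝ × ℝ => propDensity Ginv h z.1 z.2) := by
  have hv : Measurable (fun z : ℝ × ℝ => (propVar Ginv h z.1 : ℝ)) :=
    ((measurable_propVar h hG).comp measurable_fst).coe_nnreal_real
  unfold propDensity gaussianPDFReal
  fun_prop

theorem measurable_accept {p Ginv : ℝ → ℝ} (h : ℝ) (hp : Measurable p) (hG : Measurable Ginv) :
    Measurable (fun z : ℝ × ℝ => accept p Ginv h z.1 z.2) := by
  have h1 := measurable_propDensity h hG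
  have h2 : Measurable (fun z : ℝ × ℝ => propDensity Ginv h z.2 z.1) := h1.comp measurable_swap
  unfold accept
  fun_prop

/-- The proposal distributions as a kernel. -/
def proposalKernel (Ginv : ℝ → ℝ) (h : ℝ) (hG : Measurable Ginv) : Kernel ℝ ℝ where
  toFun := proposal Ginv h
  measurable' :=
    measurable_gaussianReal.comp (measurable_id.prodMk (measurable_propVar h hG))

instance (Ginv : ℝ → ℝ) (h : ℝ) (hG : Measurable Ginv) :
    IsMarkovKernel (proposalKernel Ginv h hG) :=
  ⟨fun x => inferInstanceAs (IsProbabilityMeasure (gaussianReal x (propVar Ginv h x)))⟩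

/-- The transition kernel of the position-dependent random walk Metropolis chain,
`P(x, dy) = α(x, y) Q(x, dy) + r(x) δ_x(dy)`. -/
def chain (p Ginv : ℝ → ℝ) (h : ℝ) (hp : Measurable p) (hG : Measurable Ginv) :
    Kernel ℝ ℝ where
  toFun x :=
    (proposal Ginv h x).withDensity (fun y => ENNReal.ofReal (accept p Ginv h x y)) +
      rejectProb p Ginv h x • Measure.dirac x
  measurable' := by
    have ha : Measurable (Function.uncurry
        fun x y : ℝ => ENNReal.ofReal (accept p Ginv h x y)) :=
      (measurable_accept h hp hG).ennreal_ofReal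
    refine Measure.measurable_of_measurable_coe _ fun s hs => ?_
    simp only [Measure.add_apply, Measure.smul_apply, smul_eq_mul, withDensity_apply _ hs]
    have h1 : Measurable fun x => ∫⁻ y in s, ENNReal.ofReal (accept p Ginv h x y)
        ∂(proposal Ginv h x) :=
      ha.setLIntegral_kernel_prod_right (κ := proposalKernel Ginv h hG) hs
    have h2 : Measurable (rejectProb p Ginv h) :=
      measurable_const.sub (ha.lintegral_kernel_prod_right (κ := proposalKernel Ginv h hG))
    exact h1.add (h2.mul ((Measure.measurable_coe hs).comp Measure.measurable_dirac))

/-- Total variation distance `sup_A |μ(A) - ν(A)|` over measurable sets `A`. -/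
def tvDist (μ ν : Measure ℝ) : ℝ :=
  ⨆ A : {A : Set ℝ // MeasurableSet A}, |μ.real A - ν.real A|

/-- Geometric ergodicity of the kernel `P` with limit `π`:
`‖Pⁿ(x, ·) - π‖_TV ≤ M(x) ρⁿ` for all `n`, from `π`-almost every `x`, for some finite `M > 0`
and some `ρ < 1` which does not depend on `x`. -/
def GeometricallyErgodic (P : Kernel ℝ ℝ) (π : Measure ℝ) : Prop :=
  ∃ (M : ℝ → ℝ) (ρ : ℝ), (∀ x, 0 < M x) ∧ 0 ≤ ρ ∧ ρ < 1 ∧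
    ∀ᵐ x ∂π, ∀ n : ℕ, tvDist ((P ^ n) x) π ≤ M x * ρ ^ n

/-- The density `p` is log-concave in the tails. -/
def LogConcaveInTails (p : ℝ → ℝ) : Prop :=
  ∃ x₀ a : ℝ, 0 < x₀ ∧ 0 < a ∧
    (∀ x y, x₀ ≤ x → x ≤ y → p y / p x ≤ Real.exp (-a * (y - x))) ∧
    (∀ x y, x ≤ -x₀ → y ≤ x → p y / p x ≤ Real.exp (-a * (|y| - |x|)))

/-- The density `p` has subexponential tails with exponent `β`. -/
def SubexponentialTails (p : ℝ → ℝ) (β : ℝ) : Prop :=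
  ∃ x₀ a : ℝ, 0 < x₀ ∧ 0 < a ∧
    (∀ x y, x₀ ≤ x → x ≤ y → p y / p x ≤ Real.exp (-a * (y ^ β - x ^ β))) ∧
    (∀ x y, x ≤ -x₀ → y ≤ x → p y / p x ≤ Real.exp (-a * (|y| ^ β - |x| ^ β)))

/-- `f(x) = Θ(g(x))` in the sense that `f(x) / g(x) → C` as `|x| → ∞` for some `C > 0`. -/
def ThetaAtInfinity (f g : ℝ → ℝ) : Prop :=
  ∃ C : ℝ, 0 < C ∧ Tendsto (fun x => f x / g x) (cocompact ℝ) (𝓝 C)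

/-- `f` does not oscillate in the tails: `f(y) / f(x) → 1` as `|x| → ∞` and `y / x → 1`.
Every function with `f(x) = Θ(|x|^γ)` has this property, and so has every measurable regularly
varying function. -/
def NonOscillatingTails (f : ℝ → ℝ) : Prop :=
  ∀ ε : ℝ, 0 < ε → ∃ δ R : ℝ, 0 < δ ∧ 0 < R ∧
    ∀ x y : ℝ, R ≤ |x| → |y - x| ≤ δ * |x| → |f y / f x - 1| ≤ ε

end PDRWM

end

/-! The chain is reversible, so it suffices to find an `L²` spectral gap and to convert it into
pointwise bounds. The gap comes from a Lyapunov function `V` through an elementary inequality: for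
`τ = ±1` and `V > 0`, `f(x)² (1 - V(y)/V(x)) + f(y)² (1 - V(x)/V(y)) ≤ (f(x) - τ f(y))²`. Integrated
against any symmetric kernel below the flow of accepted moves, it bounds `∫ f² · drift` by a
Dirichlet form. If the drift is at least `θ p` off a compact interval `C`, the deficit on `C` is
absorbed by the minorization of the flow on `C × C`. The sign `τ = 1` keeps the spectrum away from
`1`, and `τ = -1` keeps it away from `-1` (`exists_integral_sq_le_dirichlet`).

Self-adjointness turns the quadratic form bound into a contraction (`integral_sq_kernel_le`).
Rejection probabilities are bounded away from `1` and proposal densities are bounded, so one step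
satisfies `|Pf(x)| ≤ r |f(x)| + (D / p(x)) ‖f‖₁`. Iteration then gives geometric decay at every
point (`geometricallyErgodic_chain_of_poincare`).

The drift is computed with `V = exp(s|x|^β)`, where `p` decays like `exp(-2s|x|^β)` or faster, and
`β = 1` is the log-concave case. Only the symmetric kernel `localFlow` of moves within one standard
deviation `w` is used. Write `e = exp(-Δ)`, with `Δ` the growth of `s|x|^β` over an outward move of
length `t`. Up to the common factor `densityAtOne * p x / w`, the outward point loses at most `e(1 -
e)`, while by concavity the inward point gains nearly `1 - e`. The balance `(1 - e)²` stays away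
from `0` for `t ≥ w/2` because `w` is at least of order `|x|^(1-β)`. The hypotheses `w = o(|x|)` and
absence of oscillation make `w` nearly constant across one step (`outward_add_inward_drift_ge`,
`drift_ge_of_tail`). -/

section L2

/-! ### Poincaré inequalities from a Lyapunov function -/

variable {X : Type*} [MeasurableSpace X] {μ : Measure X}

theorem Measurable.integrable_mul_of_abs_le {g k : X → ℝ} {M : ℝ} (hg : Measurable g)
    (hgM : ∀ x, |g x| ≤ M) (hk : Integrable k μ) : Integrable (fun x => g x * k x) μ :=
  hk.bdd_mul hg.aestronglyMeasurable (c := M) (ae_of_all _ fun x => by simpa using hgM x)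

theorem abs_sq_le_of_abs_le {a M : ℝ} (h : |a| ≤ M) : |a ^ 2| ≤ M ^ 2 := by
  rw [abs_pow]; gcongr

theorem abs_sub_mul_sq_le {a b τ M : ℝ} (hτ : τ ^ 2 = 1) (ha : |a| ≤ M) (hb : |b| ≤ M) :
    |(a - τ * b) ^ 2| ≤ (2 * M) ^ 2 := by
  have h1 : |τ| = 1 := by
    rw [← sq_eq_sq₀ (abs_nonneg _) zero_le_one, sq_abs, hτ, one_pow]
  rw [abs_pow]
  gcongr
  calc |a - τ * b| ≤ |a| + |τ * b| := abs_sub _ _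
    _ = |a| + |b| := by rw [abs_mul, h1, one_mul]
    _ ≤ 2 * M := by linarith

/-- A Lyapunov function bounds a weighted `L²` norm by the Dirichlet form of a symmetric kernel,
for either sign of `τ`. -/
theorem integral_sq_mul_drift_le [SFinite μ] {κ : X × X → ℝ} {V f : X → ℝ} {τ M : ℝ}
    (hκ0 : ∀ z, 0 ≤ κ z) (hsymm : ∀ z, κ z.swap = κ z) (hV : ∀ x, 0 < V x)
    (hf : Measurable f) (hfM : ∀ x, |f x| ≤ M) (hτ : τ ^ 2 = 1)
    (hint : Integrable κ (μ.prod μ))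
    (hintV : Integrable (fun z => κ z * (V z.2 / V z.1)) (μ.prod μ)) :
    ∫ x, f x ^ 2 * ∫ y, κ (x, y) * (1 - V y / V x) ∂μ ∂μ ≤
      1 / 2 * ∫ z, (f z.1 - τ * f z.2) ^ 2 * κ z ∂(μ.prod μ) := by
  set Φ : X × X → ℝ := fun z => f z.1 ^ 2 * (κ z * (1 - V z.2 / V z.1)) with hΦ
  have hΦi : Integrable Φ (μ.prod μ) := by
    refine Measurable.integrable_mul_of_abs_le (M := M ^ 2) (by fun_prop)
      (fun z => abs_sq_le_of_abs_le (hfM _)) ?_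
    exact (hint.sub hintV).congr (ae_of_all _ fun z => by simp [mul_sub])
  have h1 : ∫ x, f x ^ 2 * ∫ y, κ (x, y) * (1 - V y / V x) ∂μ ∂μ = ∫ z, Φ z ∂(μ.prod μ) := by
    rw [integral_prod _ hΦi]
    simp only [hΦ, integral_const_mul]
  have h2 : ∫ z, Φ z.swap ∂(μ.prod μ) = ∫ z, Φ z ∂(μ.prod μ) := integral_prod_swap Φ
  have h3 : ∫ z, (Φ z + Φ z.swap) ∂(μ.prod μ) ≤
      ∫ z, (f z.1 - τ * f z.2) ^ 2 * κ z ∂(μ.prod μ) := by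
    refine integral_mono (hΦi.add hΦi.swap) ?_ fun z => ?_
    · exact Measurable.integrable_mul_of_abs_le (M := (2 * M) ^ 2) (by fun_prop)
        (fun z => abs_sub_mul_sq_le hτ (hfM _) (hfM _)) hint
    · obtain ⟨x, y⟩ := z
      have hs : κ (y, x) = κ (x, y) := hsymm (x, y)
      have hx := hV x
      have hy := hV y
      -- The two sides differ by a square divided by `V x * V y`; the sign of `τ` enters only
      -- through `τ ^ 2 = 1`.
      have key : f x ^ 2 * (1 - V y / V x) + f y ^ 2 * (1 - V x / V y) ≤
          (f x - τ * f y) ^ 2 := by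
        have : (f x - τ * f y) ^ 2 - (f x ^ 2 * (1 - V y / V x) + f y ^ 2 * (1 - V x / V y)) =
            (f x * V y - τ * f y * V x) ^ 2 / (V x * V y) := by
          field_simp
          linear_combination (V x * V y * f y ^ 2 - V x ^ 2 * f y ^ 2) * hτ
        have h0 : 0 ≤ (f x * V y - τ * f y * V x) ^ 2 / (V x * V y) := by positivity
        linarith
      simp only [hΦ, Prod.swap, hs]
      nlinarith [mul_le_mul_of_nonneg_right key (hκ0 (x, y))]
  have hΦs : Integrable (fun z : X × X => Φ z.swap) (μ.prod μ) := hΦi.swap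
  rw [integral_add hΦi hΦs, h2] at h3
  rw [h1]
  linarith

/-- On a set where a kernel is bounded below, its Dirichlet form controls the `L²` norm. -/
theorem setIntegral_sq_le_dirichlet [SFinite μ] {k : X × X → ℝ} {f : X → ℝ} {τ M m : ℝ} {C : Set X}
    (hk0 : ∀ z, 0 ≤ k z) (hC : MeasurableSet C) (hCfin : μ C ≠ ∞)
    (hkm : ∀ x ∈ C, ∀ y ∈ C, m ≤ k (x, y))
    (hf : Measurable f) (hfM : ∀ x, |f x| ≤ M) (hτ : τ ^ 2 = 1)
    (hm : 0 ≤ m) (hτf : τ * (∫ x in C, f x ∂μ) ^ 2 ≤ 0) (hint : Integrable k (μ.prod μ)) :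
    m * μ.real C * ∫ x in C, f x ^ 2 ∂μ ≤
      1 / 2 * ∫ z, (f z.1 - τ * f z.2) ^ 2 * k z ∂(μ.prod μ) := by
  have hkint : Integrable (fun z => (f z.1 - τ * f z.2) ^ 2 * k z) (μ.prod μ) :=
    Measurable.integrable_mul_of_abs_le (M := (2 * M) ^ 2) (by fun_prop)
      (fun z => abs_sub_mul_sq_le hτ (hfM _) (hfM _)) hint
  have : IsFiniteMeasure (μ.restrict C) := ⟨by simpa using hCfin.lt_top⟩
  set ν := μ.restrict C with hν
  have hfi : Integrable f ν := by
    simpa using Measurable.integrable_mul_of_abs_le hf hfM (integrable_const (μ := ν) (1 : ℝ))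
  have hf2i : Integrable (fun x => f x ^ 2) ν := by
    simpa using Measurable.integrable_mul_of_abs_le (hf.pow_const 2)
      (fun x => abs_sq_le_of_abs_le (hfM x)) (integrable_const (μ := ν) (1 : ℝ))
  have hconst : Integrable (fun _ : X => (1 : ℝ)) ν := integrable_const _
  have e1 : ∫ z, f z.1 ^ 2 ∂(ν.prod ν) = μ.real C * ∫ x, f x ^ 2 ∂ν := by
    have := integral_prod_mul (μ := ν) (ν := ν) (fun x => f x ^ 2) (fun _ => (1 : ℝ))
    simp only [mul_one, integral_const, smul_eq_mul] at this
    rw [this, hν, measureReal_restrict_apply_univ, mul_comm]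
  have e2 : ∫ z, f z.2 ^ 2 ∂(ν.prod ν) = μ.real C * ∫ x, f x ^ 2 ∂ν := by
    have := integral_prod_mul (μ := ν) (ν := ν) (fun _ => (1 : ℝ)) (fun x => f x ^ 2)
    simp only [mul_one, one_mul, integral_const, smul_eq_mul] at this
    rw [this, hν, measureReal_restrict_apply_univ]
  have e3 : ∫ z, f z.1 * f z.2 ∂(ν.prod ν) = (∫ x, f x ∂ν) ^ 2 := by
    rw [integral_prod_mul (μ := ν) (ν := ν) f f, sq]
  have i1 : Integrable (fun z : X × X => f z.1 ^ 2) (ν.prod ν) := by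
    simpa using hf2i.mul_prod hconst
  have i2 : Integrable (fun z : X × X => f z.2 ^ 2) (ν.prod ν) := by
    simpa using hconst.mul_prod hf2i
  have i3 : Integrable (fun z : X × X => f z.1 * f z.2) (ν.prod ν) := hfi.mul_prod hfi
  -- The last term is what `hτf` controls: it has the good sign for `τ = -1`, and for `τ = 1` the
  -- hypothesis forces the mean over `C` to vanish.
  have e4 : ∫ z, (f z.1 - τ * f z.2) ^ 2 ∂(ν.prod ν) =
      2 * μ.real C * ∫ x, f x ^ 2 ∂ν - 2 * τ * (∫ x, f x ∂ν) ^ 2 := by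
    have : ∀ z : X × X, (f z.1 - τ * f z.2) ^ 2 =
        (f z.1 ^ 2 + f z.2 ^ 2) - 2 * τ * (f z.1 * f z.2) := fun z => by
      linear_combination f z.2 ^ 2 * hτ
    simp_rw [this]
    have i12 : Integrable (fun z : X × X => f z.1 ^ 2 + f z.2 ^ 2) (ν.prod ν) := i1.add i2
    rw [integral_sub i12 (i3.const_mul _), integral_add i1 i2, integral_const_mul, e1, e2, e3]
    ring
  have hprod : ν.prod ν = (μ.prod μ).restrict (C ×ˢ C) := Measure.prod_restrict C C
  have h5 : ∫ z in C ×ˢ C, m * (f z.1 - τ * f z.2) ^ 2 ∂(μ.prod μ) ≤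
      ∫ z in C ×ˢ C, (f z.1 - τ * f z.2) ^ 2 * k z ∂(μ.prod μ) := by
    refine setIntegral_mono_on ?_ hkint.integrableOn (hC.prod hC) fun z hz => ?_
    · rw [IntegrableOn, ← hprod]
      have hc : Integrable (fun _ : X × X => m) (ν.prod ν) := integrable_const _
      have := Measurable.integrable_mul_of_abs_le (g := fun z : X × X => (f z.1 - τ * f z.2) ^ 2)
        (M := (2 * M) ^ 2) (by fun_prop) (fun z => abs_sub_mul_sq_le hτ (hfM _) (hfM _)) hc
      simpa [mul_comm] using this
    · rw [mul_comm]
      exact mul_le_mul_of_nonneg_left (hkm _ hz.1 _ hz.2) (sq_nonneg _)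
  have h6 : ∫ z in C ×ˢ C, (f z.1 - τ * f z.2) ^ 2 * k z ∂(μ.prod μ) ≤
      ∫ z, (f z.1 - τ * f z.2) ^ 2 * k z ∂(μ.prod μ) :=
    setIntegral_le_integral hkint (ae_of_all _ fun z => mul_nonneg (sq_nonneg _) (hk0 z))
  rw [← hprod] at h6
  rw [integral_const_mul, ← hprod, e4] at h5
  nlinarith [mul_nonneg hm (neg_nonneg.2 hτf)]

/-- A drift condition outside a set `C` and a minorization on `C × C` give a Poincaré inequality,
for either sign of `τ`. -/
theorem exists_integral_sq_le_dirichlet [SFinite μ] {k κ : X × X → ℝ} {V p : X → ℝ}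
    {θ B m MC : ℝ} {C : Set X}
    (hp0 : ∀ x, 0 ≤ p x) (hp : Integrable p μ)
    (hk : Integrable k (μ.prod μ)) (hκm : Measurable κ) (hκ0 : ∀ z, 0 ≤ κ z) (hκk : ∀ z, κ z ≤ k z)
    (hsymm : ∀ z, κ z.swap = κ z) (hV : ∀ x, 0 < V x)
    (hintV : Integrable (fun z => κ z * (V z.2 / V z.1)) (μ.prod μ))
    (hC : MeasurableSet C) (hC0 : μ C ≠ 0) (hCfin : μ C ≠ ∞) (hm : 0 < m)
    (hkm : ∀ x ∈ C, ∀ y ∈ C, m ≤ k (x, y)) (hMC : ∀ x ∈ C, p x ≤ MC) (hθ : 0 < θ)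
    (hB : 0 ≤ B)
    (hdrift : ∀ x ∉ C, θ * p x ≤ ∫ y, κ (x, y) * (1 - V y / V x) ∂μ)
    (hdriftC : ∀ x ∈ C, -B * p x ≤ ∫ y, κ (x, y) * (1 - V y / V x) ∂μ) :
    ∃ K : ℝ, 1 ≤ K ∧ ∀ (f : X → ℝ) (M τ : ℝ), Measurable f → (∀ x, |f x| ≤ M) → τ ^ 2 = 1 →
      τ * (∫ x in C, f x ∂μ) ^ 2 ≤ 0 →
      ∫ x, f x ^ 2 * p x ∂μ ≤
        K * (1 / 2 * ∫ z, (f z.1 - τ * f z.2) ^ 2 * k z ∂(μ.prod μ)) := by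
  have hCr : 0 < μ.real C := ENNReal.toReal_pos hC0 hCfin
  have hk0 : ∀ z, 0 ≤ k z := fun z => (hκ0 z).trans (hκk z)
  have hκi : Integrable κ (μ.prod μ) := hk.mono' hκm.aestronglyMeasurable
    (ae_of_all _ fun z => by rw [Real.norm_of_nonneg (hκ0 z)]; exact hκk z)
  -- With `E` the Dirichlet form, the drift gives `θ ∫ f² p ≤ E + (B + θ) ∫_C f² p`, and the
  -- minorization gives `∫_C f² p ≤ MC / (m |C|) · E`. The constant is the combination of the two.
  refine ⟨max 1 ((1 + (B + θ) * (MC / (m * μ.real C))) / θ), le_max_left _ _,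
    fun f M τ hf hfM hτ hτf => ?_⟩
  have hkint : Integrable (fun z => (f z.1 - τ * f z.2) ^ 2 * k z) (μ.prod μ) :=
    Measurable.integrable_mul_of_abs_le (M := (2 * M) ^ 2) (by fun_prop)
      (fun z => abs_sub_mul_sq_le hτ (hfM _) (hfM _)) hk
  have hκint : Integrable (fun z => (f z.1 - τ * f z.2) ^ 2 * κ z) (μ.prod μ) :=
    Measurable.integrable_mul_of_abs_le (M := (2 * M) ^ 2) (by fun_prop)
      (fun z => abs_sub_mul_sq_le hτ (hfM _) (hfM _)) hκi
  set E := 1 / 2 * ∫ z, (f z.1 - τ * f z.2) ^ 2 * k z ∂(μ.prod μ) with hE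
  have hE0 : 0 ≤ E := mul_nonneg (by norm_num)
    (integral_nonneg fun z => mul_nonneg (sq_nonneg _) (hk0 z))
  have h1 := integral_sq_mul_drift_le hκ0 hsymm hV hf hfM hτ hκi hintV
  have h2 : ∫ z, (f z.1 - τ * f z.2) ^ 2 * κ z ∂(μ.prod μ) ≤
      ∫ z, (f z.1 - τ * f z.2) ^ 2 * k z ∂(μ.prod μ) :=
    integral_mono hκint hkint fun z => mul_le_mul_of_nonneg_left (hκk z) (sq_nonneg _)
  have h3 := setIntegral_sq_le_dirichlet hk0 hC hCfin hkm hf hfM hτ hm.le hτf hk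
  have hfp : Integrable (fun x => f x ^ 2 * p x) μ :=
    Measurable.integrable_mul_of_abs_le (hf.pow_const 2) (fun x => abs_sq_le_of_abs_le (hfM x)) hp
  have hdi : Integrable (fun x => ∫ y, κ (x, y) * (1 - V y / V x) ∂μ) μ := by
    have : Integrable (fun z => κ z * (1 - V z.2 / V z.1)) (μ.prod μ) := by
      exact (hκi.sub hintV).congr (ae_of_all _ fun z => by simp [mul_sub])
    exact this.integral_prod_left
  have hfd : Integrable (fun x => f x ^ 2 * ∫ y, κ (x, y) * (1 - V y / V x) ∂μ) μ :=
    Measurable.integrable_mul_of_abs_le (hf.pow_const 2) (fun x => abs_sq_le_of_abs_le (hfM x)) hdi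
  have hfC : Integrable (C.indicator fun x => f x ^ 2 * p x) μ := hfp.indicator hC
  have h4 : ∫ x, (θ * (f x ^ 2 * p x) - (B + θ) * C.indicator (fun x => f x ^ 2 * p x) x) ∂μ ≤
      ∫ x, f x ^ 2 * ∫ y, κ (x, y) * (1 - V y / V x) ∂μ ∂μ := by
    refine integral_mono ((hfp.const_mul _).sub (hfC.const_mul _)) hfd fun x => ?_
    by_cases hx : x ∈ C
    · simp only [Set.indicator_of_mem hx]
      nlinarith [mul_le_mul_of_nonneg_left (hdriftC x hx) (sq_nonneg (f x))]
    · simp only [Set.indicator_of_notMem hx]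
      nlinarith [mul_le_mul_of_nonneg_left (hdrift x hx) (sq_nonneg (f x))]
  rw [integral_sub (hfp.const_mul _) (hfC.const_mul _), integral_const_mul, integral_const_mul,
    integral_indicator hC] at h4
  have : IsFiniteMeasure (μ.restrict C) := ⟨by simpa using hCfin.lt_top⟩
  have hf2i : Integrable (fun x => f x ^ 2) (μ.restrict C) := by
    simpa using Measurable.integrable_mul_of_abs_le (hf.pow_const 2)
      (fun x => abs_sq_le_of_abs_le (hfM x)) (integrable_const (μ := μ.restrict C) (1 : ℝ))
  have h5 : ∫ x in C, f x ^ 2 * p x ∂μ ≤ MC * ∫ x in C, f x ^ 2 ∂μ := by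
    rw [← integral_const_mul]
    refine setIntegral_mono_on hfp.integrableOn (hf2i.const_mul _) hC fun x hx => ?_
    rw [mul_comm]
    exact mul_le_mul_of_nonneg_right (hMC x hx) (sq_nonneg _)
  have hMC0 : 0 ≤ MC := by
    obtain ⟨x, hx⟩ := nonempty_of_measure_ne_zero hC0
    exact (hp0 x).trans (hMC x hx)
  have h6 : MC * ∫ x in C, f x ^ 2 ∂μ ≤ MC / (m * μ.real C) * E := by
    rw [div_mul_eq_mul_div, le_div_iff₀ (by positivity)]
    nlinarith [mul_le_mul_of_nonneg_left h3 hMC0]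
  have h7 : θ * ∫ x, f x ^ 2 * p x ∂μ ≤ (1 + (B + θ) * (MC / (m * μ.real C))) * E := by
    nlinarith [mul_le_mul_of_nonneg_left (h5.trans h6) (add_nonneg hB hθ.le)]
  calc ∫ x, f x ^ 2 * p x ∂μ ≤ (1 + (B + θ) * (MC / (m * μ.real C))) / θ * E := by
        rw [div_mul_eq_mul_div, le_div_iff₀ hθ]; linarith
    _ ≤ _ := mul_le_mul_of_nonneg_right (le_max_right _ _) hE0

/-! ### From quadratic form bounds to pointwise decay -/

variable {P : Kernel X X} {π : Measure X}

theorem Measurable.integral_kernel_apply [IsMarkovKernel P] {f : X → ℝ}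
    (hf : Measurable f) : Measurable fun x => ∫ y, f y ∂(P x) :=
  (hf.stronglyMeasurable.comp_measurable measurable_snd
    |>.integral_kernel_prod_right (κ := P) (f := fun _ y => f y)).measurable

theorem abs_integral_le_of_abs_le {ν : Measure X} [IsProbabilityMeasure ν] {f : X → ℝ} {M : ℝ}
    (hfM : ∀ x, |f x| ≤ M) : |∫ x, f x ∂ν| ≤ M := by
  simpa using norm_integral_le_of_norm_le_const (μ := ν) (ae_of_all _ fun x => (Real.norm_eq_abs (f x)).trans_le (hfM x))

theorem Measurable.integrable_of_abs_le {ν : Measure X} [IsFiniteMeasure ν] {f : X → ℝ} {M : ℝ}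
    (hf : Measurable f) (hfM : ∀ x, |f x| ≤ M) : Integrable f ν := by
  simpa using Measurable.integrable_mul_of_abs_le hf hfM (integrable_const (μ := ν) (1 : ℝ))

theorem integral_add_mul_add_mul {u v w : X → ℝ} (hu : Integrable u π) (hv : Integrable v π)
    (hw : Integrable w π) (a b : ℝ) : ∫ x, (u x + (a * v x + b * w x)) ∂π =
      ∫ x, u x ∂π + (a * ∫ x, v x ∂π + b * ∫ x, w x ∂π) := by
  have h1 : Integrable (fun x => a * v x + b * w x) π := (hv.const_mul a).add (hw.const_mul b)
  rw [integral_add hu h1, integral_add (hv.const_mul a) (hw.const_mul b), integral_const_mul,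
    integral_const_mul]

/-- For a reversible kernel, a bound on the quadratic form on mean-zero functions is a bound on
the operator norm. -/
theorem integral_sq_kernel_le [IsMarkovKernel P] [IsProbabilityMeasure π] {ρ : ℝ} (hρ : 0 < ρ)
    (hsymm : ∀ (f g : X → ℝ) (M : ℝ), Measurable f → Measurable g → (∀ x, |f x| ≤ M) →
      (∀ x, |g x| ≤ M) →
      ∫ x, f x * ∫ y, g y ∂(P x) ∂π = ∫ x, g x * ∫ y, f y ∂(P x) ∂π)
    (hquad : ∀ (f : X → ℝ) (M : ℝ), Measurable f → (∀ x, |f x| ≤ M) → ∫ x, f x ∂π = 0 →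
      |∫ x, f x * ∫ y, f y ∂(P x) ∂π| ≤ ρ * ∫ x, f x ^ 2 ∂π)
    {f : X → ℝ} {M : ℝ} (hf : Measurable f) (hfM : ∀ x, |f x| ≤ M) (hf0 : ∫ x, f x ∂π = 0) :
    ∫ x, (∫ y, f y ∂(P x)) ^ 2 ∂π ≤ ρ ^ 2 * ∫ x, f x ^ 2 ∂π := by
  set g : X → ℝ := fun x => ∫ y, f y ∂(P x) with hg
  have hgm : Measurable g := hf.integral_kernel_apply
  have hgM : ∀ x, |g x| ≤ M := fun x => abs_integral_le_of_abs_le hfM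
  have hg0 : ∫ x, g x ∂π = 0 := by
    have := hsymm (fun _ => 1) f (max 1 M) measurable_const hf (by simp)
      (fun x => (hfM x).trans (le_max_right _ _))
    simpa [hf0] using this
  set Tg : X → ℝ := fun x => ∫ y, g y ∂(P x) with hTg
  have hTgm : Measurable Tg := hgm.integral_kernel_apply
  have hTgM : ∀ x, |Tg x| ≤ M := fun x => abs_integral_le_of_abs_le hgM
  have hmul : ∀ u v : X → ℝ, Measurable u → Measurable v → (∀ x, |u x| ≤ M) → (∀ x, |v x| ≤ M) →
      Integrable (fun x => u x * v x) π := fun u v hu hv huM hvM =>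
    Measurable.integrable_mul_of_abs_le hu huM (hv.integrable_of_abs_le hvM)
  have iff' := hmul f f hf hf hfM hfM
  have ifg := hmul f g hf hgm hfM hgM
  have igg := hmul g g hgm hgm hgM hgM
  have ifT := hmul f Tg hf hTgm hfM hTgM
  have igT := hmul g Tg hgm hTgm hgM hTgM
  have hfT : ∫ x, f x * Tg x ∂π = ∫ x, g x * g x ∂π := hsymm f g M hf hgm hfM hgM
  have bound : ∀ s : ℝ, |∫ x, f x * g x ∂π + 2 * s * ∫ x, g x * g x ∂π +
      s ^ 2 * ∫ x, g x * Tg x ∂π| ≤ ρ * (∫ x, f x * f x ∂π + 2 * s * ∫ x, f x * g x ∂π +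
      s ^ 2 * ∫ x, g x * g x ∂π) := by
    intro s
    have h := hquad (fun x => f x + s * g x) (M + |s| * M) (by fun_prop)
      (fun x => (abs_add_le _ _).trans (add_le_add (hfM x) (by
        rw [abs_mul]; exact mul_le_mul_of_nonneg_left (hgM x) (abs_nonneg _))))
      (by rw [integral_add (hf.integrable_of_abs_le hfM) ((hgm.integrable_of_abs_le hgM).const_mul _),
        integral_const_mul, hf0, hg0]; simp)
    have e1 : ∀ x, ∫ y, (f y + s * g y) ∂(P x) = g x + s * Tg x := fun x => by
      rw [integral_add (hf.integrable_of_abs_le hfM) ((hgm.integrable_of_abs_le hgM).const_mul _),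
        integral_const_mul]
    have e2 : ∫ x, (f x + s * g x) * (g x + s * Tg x) ∂π = ∫ x, f x * g x ∂π +
        2 * s * ∫ x, g x * g x ∂π + s ^ 2 * ∫ x, g x * Tg x ∂π := by
      have : ∀ x, (f x + s * g x) * (g x + s * Tg x) =
          f x * g x + (s * (f x * Tg x + g x * g x) + s ^ 2 * (g x * Tg x)) :=
        fun x => by ring
      have i1 : Integrable (fun x => f x * Tg x + g x * g x) π := ifT.add igg
      simp_rw [this]
      rw [integral_add_mul_add_mul ifg i1 igT, integral_add ifT igg, hfT]
      ring
    have e3 : ∫ x, (f x + s * g x) ^ 2 ∂π = ∫ x, f x * f x ∂π +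
        2 * s * ∫ x, f x * g x ∂π + s ^ 2 * ∫ x, g x * g x ∂π := by
      have : ∀ x, (f x + s * g x) ^ 2 =
          f x * f x + (2 * s * (f x * g x) + s ^ 2 * (g x * g x)) := fun x => by ring
      simp_rw [this]
      rw [integral_add_mul_add_mul iff' ifg igg]
      ring
    simp_rw [e1] at h
    rwa [e2, e3] at h
  -- Polarization: subtracting the bounds for `f ± ρ⁻¹ g` cancels `∫ f g` and `∫ g Tg` and leaves
  -- `4ρ⁻¹ ∫ g² ≤ 2ρ ∫ f² + 2ρ⁻¹ ∫ g²`.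
  have b1 := (abs_le.1 (bound ρ⁻¹)).2
  have b2 := (abs_le.1 (bound (-ρ⁻¹))).1
  have e4 : ∫ x, f x ^ 2 ∂π = ∫ x, f x * f x ∂π := by simp_rw [sq]
  have e5 : ∫ x, (g x) ^ 2 ∂π = ∫ x, g x * g x ∂π := by simp_rw [sq]
  change ∫ x, (g x) ^ 2 ∂π ≤ _
  rw [e4, e5]
  set F := ∫ x, f x * f x ∂π
  set G := ∫ x, g x * g x ∂π
  have b3 : 4 * ρ⁻¹ * G ≤ 2 * ρ * F + 2 * (ρ * ρ⁻¹ ^ 2) * G := by linarith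
  have e6 : ρ * ρ⁻¹ ^ 2 = ρ⁻¹ := by field_simp
  rw [e6] at b3
  have b4 : ρ * (ρ⁻¹ * G) ≤ ρ * (ρ * F) := mul_le_mul_of_nonneg_left (by linarith) hρ.le
  rw [← mul_assoc, mul_inv_cancel₀ hρ.ne', one_mul] at b4
  linarith

/-- An `L²` contraction together with a pointwise bound of one step by the `L¹` norm makes the
iterates of a bounded mean-zero function decay geometrically at every point. -/
theorem abs_iterate_kernel_le [IsMarkovKernel P] [IsProbabilityMeasure π] {r ρ ρ' : ℝ} {c : X → ℝ}
    (hρ : 0 < ρ) (hrρ : r ≤ ρ) (hρ' : ρ < ρ') (hc : ∀ x, 0 ≤ c x)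
    (hinv : ∀ (f : X → ℝ) (M : ℝ), Measurable f → (∀ x, |f x| ≤ M) →
      ∫ x, ∫ y, f y ∂(P x) ∂π = ∫ x, f x ∂π)
    (hcontr : ∀ (f : X → ℝ) (M : ℝ), Measurable f → (∀ x, |f x| ≤ M) → ∫ x, f x ∂π = 0 →
      ∫ x, (∫ y, f y ∂(P x)) ^ 2 ∂π ≤ ρ ^ 2 * ∫ x, f x ^ 2 ∂π)
    (hstep : ∀ (f : X → ℝ) (M : ℝ), Measurable f → (∀ x, |f x| ≤ M) → ∀ x,
      |∫ y, f y ∂(P x)| ≤ r * |f x| + c x * ∫ y, |f y| ∂π)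
    {f : X → ℝ} (hf : Measurable f) (hfM : ∀ x, |f x| ≤ 1) (hf0 : ∫ x, f x ∂π = 0) (n : ℕ) (x : X) :
    |((fun (g : X → ℝ) z => ∫ y, g y ∂(P z))^[n] f) x| ≤ (1 + c x / (ρ' - ρ)) * ρ' ^ n := by
  set T : (X → ℝ) → X → ℝ := fun g z => ∫ y, g y ∂(P z) with hT
  have hall : ∀ n : ℕ, Measurable (T^[n] f) ∧ (∀ x, |(T^[n] f) x| ≤ 1) ∧ ∫ x, (T^[n] f) x ∂π = 0 ∧
      ∫ x, (T^[n] f) x ^ 2 ∂π ≤ (ρ ^ n) ^ 2 := by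
    intro n
    induction n with
    | zero =>
      refine ⟨hf, hfM, hf0, ?_⟩
      have h1 : ∀ x, |f x ^ 2| ≤ 1 := fun x => by simpa using abs_sq_le_of_abs_le (hfM x)
      simpa using (le_abs_self _).trans (abs_integral_le_of_abs_le (ν := π) h1)
    | succ n ih =>
      obtain ⟨h1, h2, h3, h4⟩ := ih
      rw [Function.iterate_succ_apply']
      refine ⟨h1.integral_kernel_apply, fun x => abs_integral_le_of_abs_le h2, ?_, ?_⟩
      · rw [← h3]; exact hinv _ 1 h1 h2
      · calc _ ≤ ρ ^ 2 * ∫ x, (T^[n] f) x ^ 2 ∂π := hcontr _ 1 h1 h2 h3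
          _ ≤ ρ ^ 2 * (ρ ^ n) ^ 2 := by gcongr
          _ = _ := by ring
  have hd : 0 < ρ' - ρ := sub_pos.2 hρ'
  induction n with
  | zero =>
    have := div_nonneg (hc x) hd.le
    simpa using (hfM x).trans (by linarith)
  | succ n ih =>
    obtain ⟨h1, h2, h3, h4⟩ := hall n
    have hL1 : ∫ y, |(T^[n] f) y| ∂π ≤ ρ ^ n := by
      -- The `L¹` norm is at most the `L²` norm, by nonnegativity of the variance of `|T^[n] f|`.
      refine abs_le_of_sq_le_sq' ?_ (by positivity) |>.2
      have hv := variance_nonneg (fun y => |(T^[n] f) y|) π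
      have hmem : MemLp (fun y => |(T^[n] f) y|) 2 π :=
        MemLp.of_bound h1.abs.aestronglyMeasurable 1 (ae_of_all _ fun x => by simpa using h2 x)
      rw [variance_eq_sub hmem] at hv
      simp only [Pi.pow_apply, sq_abs] at hv
      linarith
    rw [Function.iterate_succ_apply']
    have hρn : ρ ^ n ≤ ρ' ^ n := by gcongr
    -- The recursion `a (n+1) ≤ ρ * a n + c * ρ' ^ n` is preserved by `c / (ρ' - ρ) * ρ' ^ n`, which
    -- explains the constant; the strict gap `ρ < ρ'` avoids a factor `n`.
    calc |T (T^[n] f) x| ≤ r * |(T^[n] f) x| + c x * ∫ y, |(T^[n] f) y| ∂π := hstep _ 1 h1 h2 x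
      _ ≤ ρ * ((1 + c x / (ρ' - ρ)) * ρ' ^ n) + c x * ρ' ^ n := by
        refine add_le_add (mul_le_mul hrρ ih (abs_nonneg _) hρ.le)
          (mul_le_mul_of_nonneg_left (hL1.trans hρn) (hc x))
      _ = (ρ' + c x * (ρ / (ρ' - ρ) + 1)) * ρ' ^ n - (ρ' - ρ) * ρ' ^ n := by ring
      _ ≤ (ρ' + c x * (ρ / (ρ' - ρ) + 1)) * ρ' ^ n := by
        have : 0 ≤ (ρ' - ρ) * ρ' ^ n := mul_nonneg hd.le (pow_nonneg (hρ.trans hρ').le _)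
        linarith
      _ = (1 + c x / (ρ' - ρ)) * ρ' ^ (n + 1) := by
        field_simp
        ring

end L2

/-! ### Reversibility and the flow of accepted moves -/

noncomputable section

namespace PDRWM

/-- The density `π(x) q(y | x) α(x, y)` of accepted moves in stationarity. -/
def flow (p Ginv : ℝ → ℝ) (h : ℝ) (z : ℝ × ℝ) : ℝ :=
  min (p z.1 * propDensity Ginv h z.1 z.2) (p z.2 * propDensity Ginv h z.2 z.1)

section Chain

variable {p Ginv : ℝ → ℝ} {h : ℝ}

theorem BoundedAwayOnCompacts.pos {f : ℝ → ℝ} (hf : BoundedAwayOnCompacts f) (x : ℝ) : 0 < f x := by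
  obtain ⟨m, M, hm, H⟩ := hf {x} isCompact_singleton
  exact hm.trans_le (H x rfl).1

theorem coe_propVar (hh : 0 < h) (hG0 : ∀ x, 0 < Ginv x) (x : ℝ) :
    (propVar Ginv h x : ℝ) = h * Ginv x :=
  Real.coe_toNNReal _ (mul_pos hh (hG0 x)).le

theorem propVar_ne_zero (hh : 0 < h) (hG0 : ∀ x, 0 < Ginv x) (x : ℝ) : propVar Ginv h x ≠ 0 := by
  have := mul_pos hh (hG0 x)
  simpa [propVar] using this

theorem propDensity_pos (hh : 0 < h) (hG0 : ∀ x, 0 < Ginv x) (x y : ℝ) :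
    0 < propDensity Ginv h x y :=
  gaussianPDFReal_pos _ _ _ (propVar_ne_zero hh hG0 x)

theorem integral_propDensity (hh : 0 < h) (hG0 : ∀ x, 0 < Ginv x) (x : ℝ) :
    ∫ y, propDensity Ginv h x y = 1 :=
  integral_gaussianPDFReal_eq_one _ (propVar_ne_zero hh hG0 x)

theorem measurable_flow (hp : Measurable p) (hG : Measurable Ginv) :
    Measurable (flow p Ginv h) := by
  have h1 := measurable_propDensity h hG
  have h2 : Measurable (fun z : ℝ × ℝ => propDensity Ginv h z.2 z.1) := h1.comp measurable_swap
  unfold flow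
  fun_prop

theorem flow_swap (z : ℝ × ℝ) : flow p Ginv h z.swap = flow p Ginv h z := by
  simp [flow, min_comm]

theorem flow_nonneg (hp0 : ∀ x, 0 < p x) (z : ℝ × ℝ) : 0 ≤ flow p Ginv h z :=
  le_min (mul_nonneg (hp0 _).le (gaussianPDFReal_nonneg _ _ _))
    (mul_nonneg (hp0 _).le (gaussianPDFReal_nonneg _ _ _))

/-- Detailed balance: the right side is symmetric in `x` and `y`. -/
theorem mul_accept_mul_propDensity (hh : 0 < h) (hG0 : ∀ x, 0 < Ginv x) (hp0 : ∀ x, 0 < p x)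
    (x y : ℝ) : p x * (accept p Ginv h x y * propDensity Ginv h x y) = flow p Ginv h (x, y) := by
  have h1 := propDensity_pos hh hG0 x y
  have h2 := hp0 x
  simp only [accept, flow]
  rw [mul_left_comm, mul_comm, ← mul_comm (min _ _), min_mul_of_nonneg _ _ (by positivity)]
  congr 1
  · ring
  · field_simp

theorem integrable_mul_propDensity (hh : 0 < h) (hp : Measurable p) (hG : Measurable Ginv)
    (hG0 : ∀ x, 0 < Ginv x) (hp0 : ∀ x, 0 < p x) (hpi : Integrable p) :
    Integrable (fun z : ℝ × ℝ => p z.1 * propDensity Ginv h z.1 z.2) (volume.prod volume) := by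
  have hm := measurable_propDensity h hG
  rw [integrable_prod_iff (by fun_prop)]
  refine ⟨ae_of_all _ fun x =>
    (integrable_gaussianPDFReal x (propVar Ginv h x)).const_mul (p x), ?_⟩
  refine hpi.congr (ae_of_all _ fun x => ?_)
  have : ∀ y, ‖p x * propDensity Ginv h x y‖ = p x * propDensity Ginv h x y := fun y =>
    Real.norm_of_nonneg (mul_nonneg (hp0 x).le (gaussianPDFReal_nonneg _ _ _))
  simp_rw [this]
  rw [integral_const_mul, integral_propDensity hh hG0, mul_one]

theorem integrable_flow (hh : 0 < h) (hp : Measurable p) (hG : Measurable Ginv)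
    (hG0 : ∀ x, 0 < Ginv x) (hp0 : ∀ x, 0 < p x) (hpi : Integrable p) :
    Integrable (flow p Ginv h) (volume.prod volume) :=
  (integrable_mul_propDensity hh hp hG hG0 hp0 hpi).mono'
    (measurable_flow hp hG).aestronglyMeasurable (ae_of_all _ fun z => by
      rw [Real.norm_of_nonneg (flow_nonneg hp0 z)]; exact min_le_left _ _)

theorem integrable_flow_right (hp : Measurable p) (hG : Measurable Ginv) (hp0 : ∀ x, 0 < p x)
    (x : ℝ) : Integrable (fun y => flow p Ginv h (x, y)) :=
  ((integrable_gaussianPDFReal x (propVar Ginv h x)).const_mul (p x)).mono'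
    ((measurable_flow hp hG).comp measurable_prodMk_left).aestronglyMeasurable
    (ae_of_all _ fun y => by
      rw [Real.norm_of_nonneg (flow_nonneg hp0 _)]; exact min_le_left _ _)

theorem accept_nonneg (hp0 : ∀ x, 0 < p x) (x y : ℝ) : 0 ≤ accept p Ginv h x y :=
  le_min zero_le_one (div_nonneg (mul_nonneg (hp0 _).le (gaussianPDFReal_nonneg _ _ _))
    (mul_nonneg (hp0 _).le (gaussianPDFReal_nonneg _ _ _)))

theorem lintegral_accept_le_one (x : ℝ) :
    ∫⁻ y, ENNReal.ofReal (accept p Ginv h x y) ∂(proposal Ginv h x) ≤ 1 := by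
  have : IsProbabilityMeasure (proposal Ginv h x) :=
    inferInstanceAs (IsProbabilityMeasure (gaussianReal _ _))
  calc _ ≤ ∫⁻ _, 1 ∂(proposal Ginv h x) := lintegral_mono fun y => by
        rw [← ENNReal.ofReal_one]
        exact ENNReal.ofReal_le_ofReal (min_le_left _ _)
    _ = 1 := by simp

instance isMarkovKernel_chain (hp : Measurable p) (hG : Measurable Ginv) :
    IsMarkovKernel (chain p Ginv h hp hG) := by
  refine ⟨fun x => ⟨?_⟩⟩
  change ((proposal Ginv h x).withDensity (fun y => ENNReal.ofReal (accept p Ginv h x y)) +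
      rejectProb p Ginv h x • Measure.dirac x) Set.univ = 1
  simp only [Measure.add_apply, withDensity_apply _ MeasurableSet.univ, Measure.restrict_univ,
    Measure.smul_apply, measure_univ, smul_eq_mul, mul_one, rejectProb]
  exact add_tsub_cancel_of_le (lintegral_accept_le_one x)

theorem measurable_accept_right (hp : Measurable p) (hG : Measurable Ginv) (x : ℝ) :
    Measurable (accept p Ginv h x) :=
  (measurable_accept h hp hG).comp measurable_prodMk_left

theorem integral_accept_proposal (hh : 0 < h) (hG0 : ∀ x, 0 < Ginv x) (hp0 : ∀ x, 0 < p x)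
    (f : ℝ → ℝ) (x : ℝ) :
    p x * ∫ y, accept p Ginv h x y * f y ∂(proposal Ginv h x) =
      ∫ y, f y * flow p Ginv h (x, y) := by
  rw [proposal, integral_gaussianReal_eq_integral_smul (propVar_ne_zero hh hG0 x),
    ← integral_const_mul]
  refine integral_congr_ae (ae_of_all _ fun y => ?_)
  simp only [smul_eq_mul]
  rw [← mul_accept_mul_propDensity hh hG0 hp0, propDensity]
  ring

theorem mul_toReal_rejectProb (hh : 0 < h) (hp : Measurable p) (hG : Measurable Ginv)
    (hG0 : ∀ x, 0 < Ginv x) (hp0 : ∀ x, 0 < p x) (x : ℝ) :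
    p x * (rejectProb p Ginv h x).toReal = p x - ∫ y, flow p Ginv h (x, y) := by
  have h1 := integral_accept_proposal hh hG0 hp0 (fun _ => 1) x
  simp only [mul_one, one_mul] at h1
  rw [← h1, rejectProb, ENNReal.toReal_sub_of_le (lintegral_accept_le_one x) (by simp),
    integral_eq_lintegral_of_nonneg_ae (ae_of_all _ (accept_nonneg hp0 x))
      (measurable_accept_right hp hG x).aestronglyMeasurable, ENNReal.toReal_one]
  ring

/-- Multiplying by `p x` replaces acceptance rates by the symmetric flow and the rejection
probability by the defect of its marginal. -/
theorem mul_integral_chain (hh : 0 < h) (hp : Measurable p) (hG : Measurable Ginv)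
    (hG0 : ∀ x, 0 < Ginv x) (hp0 : ∀ x, 0 < p x) {f : ℝ → ℝ} {M : ℝ} (hf : Measurable f)
    (hfM : ∀ x, |f x| ≤ M) (x : ℝ) :
    p x * ∫ y, f y ∂(chain p Ginv h hp hG x) =
      (p x - ∫ y, flow p Ginv h (x, y)) * f x + ∫ y, f y * flow p Ginv h (x, y) := by
  have hP : IsProbabilityMeasure (chain p Ginv h hp hG x) := inferInstance
  have hc : chain p Ginv h hp hG x =
    (proposal Ginv h x).withDensity (fun y => ENNReal.ofReal (accept p Ginv h x y)) +
      rejectProb p Ginv h x • Measure.dirac x := rfl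
  have hi : Integrable f (chain p Ginv h hp hG x) := hf.integrable_of_abs_le hfM
  rw [hc] at hi ⊢
  rw [integral_add_measure (hi.mono_measure (Measure.le_add_right le_rfl))
      (hi.mono_measure (Measure.le_add_left le_rfl)), integral_smul_measure, integral_dirac,
    integral_withDensity_eq_integral_toReal_smul
      (measurable_accept_right hp hG x).ennreal_ofReal (by simp)]
  simp only [smul_eq_mul, ENNReal.toReal_ofReal (accept_nonneg hp0 x _)]
  rw [mul_add, integral_accept_proposal hh hG0 hp0, ← mul_assoc,
    mul_toReal_rejectProb hh hp hG hG0 hp0, add_comm]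

theorem integral_target (hp : Measurable p) (hp0 : ∀ x, 0 < p x) (f : ℝ → ℝ) :
    ∫ x, f x ∂(target p) = ∫ x, f x * p x := by
  rw [target, integral_withDensity_eq_integral_toReal_smul hp.ennreal_ofReal (by simp)]
  simp only [smul_eq_mul, ENNReal.toReal_ofReal (hp0 _).le, mul_comm]

theorem integrable_of_isProbabilityMeasure_target (hp : Measurable p) (hp0 : ∀ x, 0 < p x)
    [hprob : IsProbabilityMeasure (target p)] : Integrable p := by
  refine ⟨hp.aestronglyMeasurable, ?_⟩
  have h1 := hprob.measure_univ
  rw [target, withDensity_apply _ MeasurableSet.univ, Measure.restrict_univ] at h1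
  rw [hasFiniteIntegral_iff_ofReal (ae_of_all _ fun x => (hp0 x).le), h1]
  exact ENNReal.one_lt_top

theorem integral_flow_le (hh : 0 < h) (hp : Measurable p) (hG : Measurable Ginv)
    (hG0 : ∀ x, 0 < Ginv x) (hp0 : ∀ x, 0 < p x) (x : ℝ) :
    ∫ y, flow p Ginv h (x, y) ≤ p x := by
  have := mul_toReal_rejectProb hh hp hG hG0 hp0 x
  nlinarith [mul_nonneg (hp0 x).le (ENNReal.toReal_nonneg (a := rejectProb p Ginv h x))]

/-- The quadratic form of the chain in terms of the flow. -/
theorem integral_mul_integral_chain (hh : 0 < h) (hp : Measurable p) (hG : Measurable Ginv)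
    (hG0 : ∀ x, 0 < Ginv x) (hp0 : ∀ x, 0 < p x) (hpi : Integrable p) {f g : ℝ → ℝ} {M : ℝ}
    (hf : Measurable f) (hg : Measurable g) (hfM : ∀ x, |f x| ≤ M) (hgM : ∀ x, |g x| ≤ M) :
    ∫ x, f x * ∫ y, g y ∂(chain p Ginv h hp hG x) ∂(target p) =
      (∫ x, f x * g x * (p x - ∫ y, flow p Ginv h (x, y))) +
        ∫ z, f z.1 * g z.2 * flow p Ginv h z ∂(volume.prod volume) := by
  have hfl := integrable_flow hh hp hG hG0 hp0 hpi
  have hM : 0 ≤ M := (abs_nonneg _).trans (hfM 0)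
  have hfg : ∀ x y, |f x * g y| ≤ M * M := fun x y => by
    rw [abs_mul]; exact mul_le_mul (hfM x) (hgM y) (abs_nonneg _) hM
  have i2 : Integrable (fun z : ℝ × ℝ => f z.1 * g z.2 * flow p Ginv h z) (volume.prod volume) :=
    Measurable.integrable_mul_of_abs_le (M := M * M) (by fun_prop) (fun z => hfg _ _) hfl
  have i1 : Integrable (fun x => f x * g x * (p x - ∫ y, flow p Ginv h (x, y))) :=
    Measurable.integrable_mul_of_abs_le (M := M * M) (by fun_prop) (fun x => hfg _ _)
      (hpi.sub hfl.integral_prod_left)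
  rw [integral_target hp hp0, integral_prod _ i2, ← integral_add i1 i2.integral_prod_left]
  refine integral_congr_ae (ae_of_all _ fun x => ?_)
  have h1 := mul_integral_chain hh hp hG hG0 hp0 hg hgM x
  have h2 : ∫ y, f x * g y * flow p Ginv h (x, y) = f x * ∫ y, g y * flow p Ginv h (x, y) := by
    rw [← integral_const_mul]; simp only [mul_assoc]
  simp only [h2]
  linear_combination f x * h1

theorem integral_mul_integral_chain_comm (hh : 0 < h) (hp : Measurable p) (hG : Measurable Ginv)
    (hG0 : ∀ x, 0 < Ginv x) (hp0 : ∀ x, 0 < p x) (hpi : Integrable p) {f g : ℝ → ℝ} {M : ℝ}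
    (hf : Measurable f) (hg : Measurable g) (hfM : ∀ x, |f x| ≤ M) (hgM : ∀ x, |g x| ≤ M) :
    ∫ x, f x * ∫ y, g y ∂(chain p Ginv h hp hG x) ∂(target p) =
      ∫ x, g x * ∫ y, f y ∂(chain p Ginv h hp hG x) ∂(target p) := by
  rw [integral_mul_integral_chain hh hp hG hG0 hp0 hpi hf hg hfM hgM,
    integral_mul_integral_chain hh hp hG hG0 hp0 hpi hg hf hgM hfM]
  congr 1
  · simp only [mul_comm (f _)]
  · rw [← integral_prod_swap]
    simp only [Prod.fst_swap, Prod.snd_swap, flow_swap, mul_comm (f _)]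

/-- The Dirichlet forms of the flow bound the quadratic forms of `1 ∓ P`. -/
theorem dirichlet_flow_le (hh : 0 < h) (hp : Measurable p) (hG : Measurable Ginv)
    (hG0 : ∀ x, 0 < Ginv x) (hp0 : ∀ x, 0 < p x) (hpi : Integrable p) {f : ℝ → ℝ} {M τ : ℝ}
    (hf : Measurable f) (hfM : ∀ x, |f x| ≤ M) (hτ : τ = 1 ∨ τ = -1) :
    1 / 2 * ∫ z, (f z.1 - τ * f z.2) ^ 2 * flow p Ginv h z ∂(volume.prod volume) ≤
      ∫ x, f x ^ 2 ∂(target p) -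
        τ * ∫ x, f x * ∫ y, f y ∂(chain p Ginv h hp hG x) ∂(target p) := by
  have hfl := integrable_flow hh hp hG hG0 hp0 hpi
  have hM : 0 ≤ M := (abs_nonneg _).trans (hfM 0)
  have hff : ∀ x y, |f x * f y| ≤ M * M := fun x y => by
    rw [abs_mul]; exact mul_le_mul (hfM x) (hfM y) (abs_nonneg _) hM
  have i0 : Integrable (fun z : ℝ × ℝ => f z.1 * f z.1 * flow p Ginv h z) (volume.prod volume) :=
    Measurable.integrable_mul_of_abs_le (M := M * M) (by fun_prop) (fun z => hff _ _) hfl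
  have i0' : Integrable (fun z : ℝ × ℝ => f z.2 * f z.2 * flow p Ginv h z) (volume.prod volume) :=
    Measurable.integrable_mul_of_abs_le (M := M * M) (by fun_prop) (fun z => hff _ _) hfl
  have i2 : Integrable (fun z : ℝ × ℝ => f z.1 * f z.2 * flow p Ginv h z) (volume.prod volume) :=
    Measurable.integrable_mul_of_abs_le (M := M * M) (by fun_prop) (fun z => hff _ _) hfl
  have i3 : Integrable (fun x => f x * f x * p x) :=
    Measurable.integrable_mul_of_abs_le (M := M * M) (by fun_prop) (fun x => hff _ _) hpi
  have i4 : Integrable (fun x => f x * f x * ∫ y, flow p Ginv h (x, y)) :=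
    Measurable.integrable_mul_of_abs_le (M := M * M) (by fun_prop) (fun x => hff _ _)
      hfl.integral_prod_left
  have e0 : ∫ z : ℝ × ℝ, f z.1 * f z.1 * flow p Ginv h z ∂(volume.prod volume) =
      ∫ x, f x * f x * ∫ y, flow p Ginv h (x, y) := by
    rw [integral_prod _ i0]; simp only [integral_const_mul]
  have e0' : ∫ z : ℝ × ℝ, f z.2 * f z.2 * flow p Ginv h z ∂(volume.prod volume) =
      ∫ z : ℝ × ℝ, f z.1 * f z.1 * flow p Ginv h z ∂(volume.prod volume) := by
    rw [← integral_prod_swap]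
    simp only [Prod.snd_swap, flow_swap]
  have e1 : ∫ x, f x * f x * (p x - ∫ y, flow p Ginv h (x, y)) =
      (∫ x, f x * f x * p x) - ∫ x, f x * f x * ∫ y, flow p Ginv h (x, y) := by
    simp only [mul_sub]; exact integral_sub i3 i4
  have e2 : ∫ z, (f z.1 - τ * f z.2) ^ 2 * flow p Ginv h z ∂(volume.prod volume) =
      2 * (∫ x, f x * f x * ∫ y, flow p Ginv h (x, y)) -
        2 * τ * ∫ z : ℝ × ℝ, f z.1 * f z.2 * flow p Ginv h z ∂(volume.prod volume) := by
    have hτ2 : τ ^ 2 = 1 := by rcases hτ with rfl | rfl <;> norm_num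
    have : ∀ z : ℝ × ℝ, (f z.1 - τ * f z.2) ^ 2 * flow p Ginv h z =
        f z.1 * f z.1 * flow p Ginv h z + (1 * (f z.2 * f z.2 * flow p Ginv h z) +
          (-(2 * τ)) * (f z.1 * f z.2 * flow p Ginv h z)) := fun z => by
      linear_combination (f z.2 ^ 2 * flow p Ginv h z) * hτ2
    simp_rw [this]
    rw [integral_add_mul_add_mul i0 i0' i2, e0', e0]
    ring
  -- The two sides of the claim differ by `(1 - τ)` times the rejected mass weighted by `f²`. This
  -- vanishes for `τ = 1` and is nonnegative for `τ = -1`.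
  have e3 : ∫ x, f x * f x * ∫ y, flow p Ginv h (x, y) ≤ ∫ x, f x * f x * p x :=
    integral_mono i4 i3 fun x =>
      mul_le_mul_of_nonneg_left (integral_flow_le hh hp hG hG0 hp0 x) (mul_self_nonneg _)
  rw [integral_mul_integral_chain hh hp hG hG0 hp0 hpi hf hf hfM hfM, integral_target hp hp0, e1, e2]
  simp only [sq]
  rcases hτ with rfl | rfl <;> linarith

/-! ### Geometric ergodicity from a Poincaré inequality -/

theorem tvDist_le_of_forall {μ ν : Measure ℝ} {c : ℝ}
    (H : ∀ A, MeasurableSet A → |μ.real A - ν.real A| ≤ c) : tvDist μ ν ≤ c := by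
  have : Nonempty {A : Set ℝ // MeasurableSet A} := ⟨⟨∅, MeasurableSet.empty⟩⟩
  exact ciSup_le fun A => H A.1 A.2

/-- Chapman–Kolmogorov, with the constant preserved because `P` is Markov. With `c = π(A)` the
iterates measure the distance to stationarity on `A`. -/
theorem iterate_indicator_sub (P : Kernel ℝ ℝ) [IsMarkovKernel P] {A : Set ℝ}
    (hA : MeasurableSet A) (c : ℝ) (n : ℕ) :
    (fun (g : ℝ → ℝ) z => ∫ y, g y ∂(P z))^[n] (fun x => A.indicator (fun _ => (1 : ℝ)) x - c) =
      fun x => ((P ^ n) x).real A - c := by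
  have hM : ∀ n x, IsProbabilityMeasure ((P ^ n) x) := by
    intro n
    induction n with
    | zero => intro x; exact inferInstanceAs (IsProbabilityMeasure (Measure.dirac x))
    | succ n ih =>
      intro x
      have : IsMarkovKernel (P ^ n) := ⟨ih⟩
      rw [pow_succ]
      exact inferInstanceAs (IsProbabilityMeasure ((Kernel.comp (P ^ n) P) x))
  induction n with
  | zero =>
    funext x
    have : ((P ^ 0) x) = Measure.dirac x := rfl
    rw [Function.iterate_zero_apply, this, Measure.real, Measure.dirac_apply' _ hA]
    by_cases hx : x ∈ A <;> simp [hx]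
  | succ n ih =>
    rw [Function.iterate_succ_apply', ih]
    funext x
    have : IsMarkovKernel (P ^ n) := ⟨hM n⟩
    have hm : Measurable fun y => ((P ^ n) y).real A := ((P ^ n).measurable_coe hA).ennreal_toReal
    have hb : ∀ y, |((P ^ n) y).real A| ≤ 1 := fun y => by
      rw [abs_of_nonneg measureReal_nonneg]; exact measureReal_le_one
    have e1 : (P ^ (n + 1)) x A = ∫⁻ y, (P ^ n) y A ∂P x := by
      rw [pow_succ]; exact Kernel.comp_apply' _ _ _ hA
    rw [integral_sub (hm.integrable_of_abs_le hb) (integrable_const c)]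
    simp only [Measure.real]
    rw [integral_toReal ((P ^ n).measurable_coe hA).aemeasurable
      (ae_of_all _ fun y => measure_lt_top _ _), e1]
    simp

/-- The chain is geometrically ergodic as soon as the flow satisfies a Poincaré inequality for both
signs, moves are accepted with probability bounded below, and proposal densities are bounded. -/
theorem geometricallyErgodic_chain_of_poincare (hh : 0 < h) (hp : Measurable p)
    (hG : Measurable Ginv) (hG0 : ∀ x, 0 < Ginv x) (hp0 : ∀ x, 0 < p x)
    [IsProbabilityMeasure (target p)] {K D θ : ℝ} {C : Set ℝ} (hC0 : volume C ≠ 0)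
    (hCfin : volume C ≠ ∞) (hK1 : 1 ≤ K)
    (hK : ∀ (f : ℝ → ℝ) (M τ : ℝ), Measurable f → (∀ x, |f x| ≤ M) → τ ^ 2 = 1 →
      τ * (∫ x in C, f x) ^ 2 ≤ 0 →
      ∫ x, f x ^ 2 * p x ≤
        K * (1 / 2 * ∫ z, (f z.1 - τ * f z.2) ^ 2 * flow p Ginv h z ∂(volume.prod volume)))
    (hD : ∀ x y, propDensity Ginv h x y ≤ D) (hθ : 0 < θ)
    (hacc : ∀ x, θ * p x ≤ ∫ y, flow p Ginv h (x, y)) :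
    GeometricallyErgodic (chain p Ginv h hp hG) (target p) := by
  have hpi : Integrable p := integrable_of_isProbabilityMeasure_target hp hp0
  set P := chain p Ginv h hp hG with hP
  have hK0 : 0 < K := by linarith
  have hD0 : 0 ≤ D := (propDensity_pos hh hG0 0 0).le.trans (hD 0 0)
  have hθ1 : θ ≤ 1 := by
    have := (hacc 0).trans (integral_flow_le hh hp hG hG0 hp0 0)
    exact le_of_mul_le_mul_right (by simpa using this) (hp0 0)
  -- the quadratic form on mean-zero functions
  have hquad : ∀ (f : ℝ → ℝ) (M : ℝ), Measurable f → (∀ x, |f x| ≤ M) → ∫ x, f x ∂(target p) = 0 →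
      |∫ x, f x * ∫ y, f y ∂(P x) ∂(target p)| ≤ (1 - K⁻¹) * ∫ x, f x ^ 2 ∂(target p) := by
    intro f M hf hfM hf0
    have key : ∀ u v : ℝ, u ≤ K * v → K⁻¹ * u ≤ v := fun u v huv => by
      rwa [inv_mul_le_iff₀ hK0]
    have hneg : K⁻¹ * ∫ x, f x ^ 2 ∂(target p) ≤ ∫ x, f x ^ 2 ∂(target p) -
        (-1) * ∫ x, f x * ∫ y, f y ∂(P x) ∂(target p) := by
      refine (key _ _ ?_).trans (dirichlet_flow_le hh hp hG hG0 hp0 hpi hf hfM (Or.inr rfl))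
      rw [integral_target hp hp0]
      exact hK f M (-1) hf hfM (by norm_num) (by nlinarith [sq_nonneg (∫ x in C, f x)])
    have hpos : K⁻¹ * ∫ x, f x ^ 2 ∂(target p) ≤ ∫ x, f x ^ 2 ∂(target p) -
        1 * ∫ x, f x * ∫ y, f y ∂(P x) ∂(target p) := by
      refine (key _ _ ?_).trans (dirichlet_flow_le hh hp hG hG0 hp0 hpi hf hfM (Or.inl rfl))
      -- Centring over `C` with respect to Lebesgue measure makes `hK` applicable. It leaves the
      -- Dirichlet form for `τ = 1` unchanged and, as `f` has `π`-mean zero, only increases `∫ f²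
      -- dπ`, by `c²`.
      set c : ℝ := (∫ x in C, f x) / volume.real C with hc
      have hCr : volume.real C ≠ 0 := (ENNReal.toReal_pos hC0 hCfin).ne'
      have hfin : IsFiniteMeasure (volume.restrict C) := ⟨by simpa using hCfin.lt_top⟩
      have hgm : Measurable fun x => f x - c := hf.sub_const c
      have hgM : ∀ x, |f x - c| ≤ M + |c| := fun x =>
        (abs_sub _ _).trans (by gcongr; exact hfM x)
      have h1 := hK (fun x => f x - c) (M + |c|) 1 hgm hgM (by norm_num) (by
        rw [integral_sub (hf.integrable_of_abs_le hfM) (integrable_const c)]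
        simp [hc, hCr, mul_div_cancel₀])
      have h2 : ∀ z : ℝ × ℝ, (f z.1 - c - 1 * (f z.2 - c)) ^ 2 = (f z.1 - 1 * f z.2) ^ 2 :=
        fun z => by ring
      simp only [h2] at h1
      refine le_trans ?_ h1
      rw [← integral_target hp hp0 fun x => (f x - c) ^ 2]
      have h3 : ∀ x, (f x - c) ^ 2 = f x ^ 2 + ((-(2 * c)) * f x + c ^ 2 * 1) := fun x => by ring
      simp only [h3]
      rw [integral_add_mul_add_mul ((hf.pow_const 2).integrable_of_abs_le
        (fun x => abs_sq_le_of_abs_le (hfM x))) (hf.integrable_of_abs_le hfM) (integrable_const 1),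
        hf0]
      simp only [integral_const, probReal_univ, smul_eq_mul]
      nlinarith [sq_nonneg c]
    rw [abs_le]
    constructor <;> linarith
  -- One rate serves both the `L²` contraction and the rejection probability; `θ / 2` in place of
  -- `θ` keeps it positive even when `θ = 1`.
  set r := max (1 - K⁻¹) (1 - θ / 2) with hr
  have hr1 : r < 1 := max_lt (by have := inv_pos.2 hK0; linarith) (by linarith)
  have hr0 : 0 < r := lt_max_of_lt_right (by linarith)
  have hcontr : ∀ (f : ℝ → ℝ) (M : ℝ), Measurable f → (∀ x, |f x| ≤ M) →
      ∫ x, f x ∂(target p) = 0 →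
      ∫ x, (∫ y, f y ∂(P x)) ^ 2 ∂(target p) ≤ r ^ 2 * ∫ x, f x ^ 2 ∂(target p) := by
    intro f M hf hfM hf0
    refine integral_sq_kernel_le hr0 (fun f g M hf hg hfM hgM =>
      integral_mul_integral_chain_comm hh hp hG hG0 hp0 hpi hf hg hfM hgM)
      (fun f M hf hfM hf0 => (hquad f M hf hfM hf0).trans ?_) hf hfM hf0
    exact mul_le_mul_of_nonneg_right (le_max_left _ _) (integral_nonneg fun x => sq_nonneg _)
  have hinv : ∀ (f : ℝ → ℝ) (M : ℝ), Measurable f → (∀ x, |f x| ≤ M) →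
      ∫ x, ∫ y, f y ∂(P x) ∂(target p) = ∫ x, f x ∂(target p) := by
    intro f M hf hfM
    have := integral_mul_integral_chain_comm hh hp hG hG0 hp0 hpi
      (f := fun _ => 1) (g := f) (M := max 1 M) measurable_const hf (by simp)
      (fun x => (hfM x).trans (le_max_right _ _))
    simpa using this
  have hstep : ∀ (f : ℝ → ℝ) (M : ℝ), Measurable f → (∀ x, |f x| ≤ M) → ∀ x,
      |∫ y, f y ∂(P x)| ≤ r * |f x| + D / p x * ∫ y, |f y| ∂(target p) := by
    intro f M hf hfM x
    have hpx := hp0 x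
    have h1 := mul_integral_chain hh hp hG hG0 hp0 hf hfM x
    have h2 : |∫ y, f y * flow p Ginv h (x, y)| ≤ D * ∫ y, |f y| * p y := by
      rw [← integral_const_mul]
      refine (abs_integral_le_integral_abs).trans (integral_mono ?_ ?_ fun y => ?_)
      · exact (Measurable.integrable_mul_of_abs_le hf hfM
          (integrable_flow_right hp hG hp0 x)).abs
      · exact (Measurable.integrable_mul_of_abs_le hf.abs (fun x => (abs_abs (f x)).trans_le (hfM x))
          hpi).const_mul _
      · simp only
        rw [abs_mul, abs_of_nonneg (flow_nonneg hp0 _)]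
        -- Bounding the flow by the reverse move leaves the weight `p y`, which produces an `L¹(π)`
        -- norm.
        have h3 : flow p Ginv h (x, y) ≤ p y * D :=
          (min_le_right _ _).trans (mul_le_mul_of_nonneg_left (hD _ _) (hp0 y).le)
        nlinarith [mul_le_mul_of_nonneg_left h3 (abs_nonneg (f y))]
    have h4 : |p x - ∫ y, flow p Ginv h (x, y)| ≤ r * p x := by
      rw [abs_of_nonneg (by linarith [integral_flow_le hh hp hG hG0 hp0 x])]
      have h5 : (1 - θ / 2) * p x ≤ r * p x := by gcongr; exact le_max_right _ _
      nlinarith [hacc x, mul_pos hθ hpx]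
    rw [integral_target hp hp0]
    have h6 : p x * |∫ y, f y ∂(P x)| ≤ r * p x * |f x| + D * ∫ y, |f y| * p y := by
      rw [← abs_of_pos hpx, ← abs_mul, abs_of_pos hpx, h1]
      refine (abs_add_le _ _).trans (add_le_add ?_ h2)
      rw [abs_mul]
      exact mul_le_mul_of_nonneg_right h4 (abs_nonneg _)
    refine le_of_mul_le_mul_left (h6.trans_eq ?_) hpx
    field_simp
  set ρ := (1 + r) / 2 with hρ
  have hrρ : r < ρ := by rw [hρ]; linarith
  have hc : ∀ x, 0 ≤ D / p x := fun x => div_nonneg hD0 (hp0 x).le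
  refine ⟨fun x => 1 + D / p x / (ρ - r), ρ, fun x => ?_, (hr0.trans hrρ).le, by rw [hρ]; linarith,
    ae_of_all _ fun x n => tvDist_le_of_forall fun A hA => ?_⟩
  · have := div_nonneg (hc x) (sub_pos.2 hrρ).le
    linarith
  have hind : Measurable (A.indicator fun _ => (1 : ℝ)) := measurable_const.indicator hA
  have hA1 : (target p).real A ≤ 1 := measureReal_le_one
  have hA0 : 0 ≤ (target p).real A := measureReal_nonneg
  have := abs_iterate_kernel_le (P := P) hr0 le_rfl hrρ hc hinv hcontr hstep
    (f := fun x => A.indicator (fun _ => (1 : ℝ)) x - (target p).real A) (by fun_prop)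
    (fun x => by
      by_cases hx : x ∈ A
      · rw [Set.indicator_of_mem hx, abs_le]; constructor <;> linarith
      · rw [Set.indicator_of_notMem hx, abs_le]; constructor <;> linarith)
    (by
      rw [integral_sub ((integrable_const 1).indicator hA) (integrable_const _),
        integral_indicator_const _ hA]
      simp) n x
  rwa [iterate_indicator_sub P hA] at this

end Chain

/-! ### Local moves within one standard deviation -/

/-- The standard deviation of the proposal made from `x`. -/
def stepSize (Ginv : ℝ → ℝ) (h x : ℝ) : ℝ := √(h * Ginv x)

/-- The standard normal density one standard deviation away from its mean. -/
def densityAtOne : ℝ := (√(2 * Real.pi))⁻¹ * Real.exp (-(1 / 2))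

/-- A symmetric kernel below `flow`, restricted to moves of at most one standard deviation which
do not cross the origin. -/
def localFlow (p Ginv : ℝ → ℝ) (h : ℝ) (z : ℝ × ℝ) : ℝ :=
  if 0 < z.1 * z.2 ∧ |z.2 - z.1| ≤ min (stepSize Ginv h z.1) (stepSize Ginv h z.2) then
    densityAtOne * min (p z.1) (p z.2) / max (stepSize Ginv h z.1) (stepSize Ginv h z.2)
  else 0

theorem densityAtOne_pos : 0 < densityAtOne := by
  have := Real.pi_pos
  unfold densityAtOne
  positivity

section LocalFlow

variable {p Ginv : ℝ → ℝ} {h : ℝ}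

theorem stepSize_pos (hh : 0 < h) (hG0 : ∀ x, 0 < Ginv x) (x : ℝ) : 0 < stepSize Ginv h x :=
  Real.sqrt_pos.2 (mul_pos hh (hG0 x))

theorem propDensity_eq (hh : 0 < h) (hG0 : ∀ x, 0 < Ginv x) (x y : ℝ) :
    propDensity Ginv h x y = (√(2 * Real.pi))⁻¹ * (stepSize Ginv h x)⁻¹ *
      Real.exp (-(y - x) ^ 2 / (2 * stepSize Ginv h x ^ 2)) := by
  have h0 := mul_pos hh (hG0 x)
  rw [propDensity, gaussianPDFReal, coe_propVar hh hG0, stepSize, Real.sq_sqrt h0.le,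
    Real.sqrt_mul (by positivity), mul_inv]

theorem densityAtOne_div_le_propDensity (hh : 0 < h) (hG0 : ∀ x, 0 < Ginv x) {x y : ℝ}
    (hxy : |y - x| ≤ stepSize Ginv h x) :
    densityAtOne / stepSize Ginv h x ≤ propDensity Ginv h x y := by
  have hw := stepSize_pos hh hG0 x
  rw [propDensity_eq hh hG0, densityAtOne, div_eq_mul_inv, mul_right_comm]
  gcongr
  rw [neg_div, neg_le_neg_iff, div_le_div_iff₀ (by positivity) (by norm_num)]
  have := sq_le_sq' (by linarith [abs_nonneg (y - x)]) hxy
  rw [sq_abs] at this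
  linarith

theorem propDensity_le (hh : 0 < h) (hG0 : ∀ x, 0 < Ginv x) (x y : ℝ) :
    propDensity Ginv h x y ≤ (√(2 * Real.pi))⁻¹ * (stepSize Ginv h x)⁻¹ := by
  have hw := stepSize_pos hh hG0 x
  have := Real.pi_pos
  rw [propDensity_eq hh hG0]
  refine mul_le_of_le_one_right (by positivity) (Real.exp_le_one_iff.2 ?_)
  rw [neg_div, neg_nonpos]
  positivity

theorem localFlow_nonneg (hh : 0 < h) (hG0 : ∀ x, 0 < Ginv x) (hp0 : ∀ x, 0 < p x) (z : ℝ × ℝ) :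
    0 ≤ localFlow p Ginv h z := by
  have h1 := densityAtOne_pos
  have h2 := stepSize_pos hh hG0 z.1
  have h3 : 0 < min (p z.1) (p z.2) := lt_min (hp0 _) (hp0 _)
  unfold localFlow
  split_ifs
  · have : 0 < max (stepSize Ginv h z.1) (stepSize Ginv h z.2) := lt_max_of_lt_left h2
    positivity
  · rfl

theorem localFlow_swap (z : ℝ × ℝ) : localFlow p Ginv h z.swap = localFlow p Ginv h z := by
  simp only [localFlow, Prod.fst_swap, Prod.snd_swap, mul_comm z.2, abs_sub_comm z.1,
    min_comm (stepSize Ginv h z.2), max_comm (stepSize Ginv h z.2), min_comm (p z.2)]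

theorem measurable_stepSize (hG : Measurable Ginv) : Measurable (stepSize Ginv h) :=
  (hG.const_mul h).sqrt

theorem measurable_localFlow (hp : Measurable p) (hG : Measurable Ginv) :
    Measurable (localFlow p Ginv h) := by
  have hw := measurable_stepSize (h := h) hG
  unfold localFlow
  have hw1 : Measurable fun z : ℝ × ℝ => stepSize Ginv h z.1 := hw.comp measurable_fst
  have hw2 : Measurable fun z : ℝ × ℝ => stepSize Ginv h z.2 := hw.comp measurable_snd
  refine Measurable.ite ?_ (by fun_prop) measurable_const
  exact (measurableSet_lt measurable_const (measurable_fst.mul measurable_snd)).inter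
    (measurableSet_le (measurable_snd.sub measurable_fst).abs (hw1.min hw2))

/-- The local flow with `p z.1` in place of one of the two target densities. -/
theorem localFlow_mul_le (hh : 0 < h) (hG0 : ∀ x, 0 < Ginv x) (hp0 : ∀ x, 0 < p x)
    {x y a B : ℝ} (ha : 0 ≤ a) (hB : 0 ≤ B)
    (H : 0 < x * y → |y - x| ≤ stepSize Ginv h x → min (p x) (p y) * a ≤ B * p x) :
    localFlow p Ginv h (x, y) * a ≤ B * (p x * propDensity Ginv h x y) := by
  have hw := stepSize_pos hh hG0 x
  have hc := densityAtOne_pos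
  have hq := propDensity_pos hh hG0 x y
  have hpx := hp0 x
  unfold localFlow
  split_ifs with hxy
  · obtain ⟨h1, h2⟩ := hxy
    have h3 := h2.trans (min_le_left _ _)
    have h4 := densityAtOne_div_le_propDensity hh hG0 h3
    have h5 : 0 < min (p x) (p y) := lt_min (hp0 _) (hp0 _)
    calc densityAtOne * min (p x) (p y) / max (stepSize Ginv h x) (stepSize Ginv h y) * a
        ≤ densityAtOne * min (p x) (p y) / stepSize Ginv h x * a := by
          gcongr; exact le_max_left _ _
      _ = densityAtOne / stepSize Ginv h x * (min (p x) (p y) * a) := by ring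
      _ ≤ propDensity Ginv h x y * (B * p x) :=
        mul_le_mul h4 (H h1 h3) (by positivity) hq.le
      _ = _ := by ring
  · rw [zero_mul]; positivity

theorem localFlow_le_mul_propDensity (hh : 0 < h) (hG0 : ∀ x, 0 < Ginv x) (hp0 : ∀ x, 0 < p x)
    (x y : ℝ) : localFlow p Ginv h (x, y) ≤ p x * propDensity Ginv h x y := by
  simpa using localFlow_mul_le (y := y) hh hG0 hp0 zero_le_one zero_le_one
    (x := x) fun _ _ => by simp

theorem localFlow_le_flow (hh : 0 < h) (hG0 : ∀ x, 0 < Ginv x) (hp0 : ∀ x, 0 < p x) (z : ℝ × ℝ) :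
    localFlow p Ginv h z ≤ flow p Ginv h z := by
  refine le_min (localFlow_le_mul_propDensity hh hG0 hp0 z.1 z.2) ?_
  rw [← localFlow_swap]
  exact localFlow_le_mul_propDensity hh hG0 hp0 z.2 z.1

end LocalFlow

/-! ### Lyapunov drift in the tails -/

section Drift

/-- Midpoint concavity of the power. It makes the decrease of `log V` over an inward move at least
its increase over the outward move of the same length. -/
theorem rpow_add_sub_le_sub_rpow_sub {β X t : ℝ} (hβ0 : 0 ≤ β) (hβ1 : β ≤ 1) (ht : 0 ≤ t)
    (htX : t ≤ X) : (X + t) ^ β - X ^ β ≤ X ^ β - (X - t) ^ β := by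
  have hc := (Real.concaveOn_rpow hβ0 hβ1).2 (Set.mem_Ici.2 (show 0 ≤ X + t by linarith))
    (Set.mem_Ici.2 (show 0 ≤ X - t by linarith)) (show (0 : ℝ) ≤ 1 / 2 by norm_num)
    (show (0 : ℝ) ≤ 1 / 2 by norm_num) (by norm_num)
  simp only [smul_eq_mul] at hc
  have e : 1 / 2 * (X + t) + 1 / 2 * (X - t) = X := by ring
  rw [e] at hc
  linarith

/-- Bernoulli's inequality for `X / (X + t) = 1 - t / (X + t)`, followed by `X + t ≤ 2 * X`. -/
theorem mul_le_rpow_add_sub {β X t : ℝ} (hβ0 : 0 < β) (hβ1 : β ≤ 1) (hX : 0 < X) (ht : 0 ≤ t)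
    (htX : t ≤ X) : β * (2 * X) ^ (β - 1) * t ≤ (X + t) ^ β - X ^ β := by
  have hY : 0 < X + t := by linarith
  have h1 := rpow_one_add_le_one_add_mul_self (s := -(t / (X + t))) (p := β)
    (by rw [neg_le_neg_iff, div_le_one hY]; linarith) hβ0.le hβ1
  have e1 : 1 + -(t / (X + t)) = X / (X + t) := by field_simp; ring
  rw [e1, Real.div_rpow hX.le hY.le, div_le_iff₀ (by positivity)] at h1
  have h2 : (2 * X) ^ (β - 1) ≤ (X + t) ^ (β - 1) :=
    Real.rpow_le_rpow_of_nonpos hY (by linarith) (by linarith)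
  have e2 : (X + t) ^ (β - 1) = (X + t) ^ β / (X + t) := by
    rw [Real.rpow_sub hY, Real.rpow_one]
  calc β * (2 * X) ^ (β - 1) * t ≤ β * ((X + t) ^ β / (X + t)) * t := by
        rw [← e2]; gcongr
    _ = β * (t / (X + t)) * (X + t) ^ β := by ring
    _ ≤ _ := by linarith

/-- The tail condition on the target density, on both sides at once. -/
def TailDecay (p : ℝ → ℝ) (β s x₀ : ℝ) : Prop :=
  ∀ x y, 0 < x * y → x₀ ≤ |x| → |x| ≤ |y| → p y ≤ p x * Real.exp (-(2 * s * (|y| ^ β - |x| ^ β)))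

/-- The Lyapunov function. -/
def lyapunov (β s x : ℝ) : ℝ := Real.exp (s * |x| ^ β)

theorem lyapunov_pos (β s x : ℝ) : 0 < lyapunov β s x := Real.exp_pos _

theorem lyapunov_div (β s x y : ℝ) :
    lyapunov β s y / lyapunov β s x = Real.exp (s * (|y| ^ β - |x| ^ β)) := by
  rw [lyapunov, lyapunov, ← Real.exp_sub, mul_sub]

theorem measurable_lyapunov (β s : ℝ) : Measurable (lyapunov β s) := by
  unfold lyapunov
  fun_prop

variable {p Ginv : ℝ → ℝ} {h β s x₀ : ℝ}

/-- Supplies integrability of the kernel weighted by `V(y)/V(x)` and the lower bound on the drift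
inside the compact set. In the tails, the decay of `p` outweighs the growth of `V` on outward moves,
and inward moves decrease `V`. -/
theorem exists_localFlow_mul_lyapunov_le (hh : 0 < h) (hG0 : ∀ x, 0 < Ginv x)
    (hp0 : ∀ x, 0 < p x) (hGc : BoundedAwayOnCompacts Ginv) (hβ0 : 0 < β) (hs : 0 < s)
    (hx₀ : 0 < x₀) (htail : TailDecay p β s x₀) :
    ∃ B : ℝ, 0 ≤ B ∧ ∀ x y, localFlow p Ginv h (x, y) * (lyapunov β s y / lyapunov β s x) ≤
      B * (p x * propDensity Ginv h x y) := by
  obtain ⟨g, Γ, hg, hΓ⟩ := hGc (Set.Icc (-x₀) x₀) isCompact_Icc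
  -- From `|x| ≤ x₀` a local move reaches at most `x₀ + √(h * Γ)`.
  set B := Real.exp (s * (x₀ + √(h * Γ)) ^ β) with hB
  have hB1 : 1 ≤ B := Real.one_le_exp (by positivity)
  refine ⟨B, by linarith, fun x y => localFlow_mul_le hh hG0 hp0
    (div_pos (lyapunov_pos _ _ _) (lyapunov_pos _ _ _)).le (by linarith) fun h1 h2 => ?_⟩
  have hpx := hp0 x
  rw [lyapunov_div]
  rcases le_total x₀ |x| with hx | hx
  · refine le_trans ?_ (le_mul_of_one_le_left hpx.le hB1)
    rcases le_total |y| |x| with hyx | hxy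
    · refine (mul_le_of_le_one_right (lt_min hpx (hp0 y)).le (Real.exp_le_one_iff.2 ?_)).trans
        (min_le_left _ _)
      have := Real.rpow_le_rpow (abs_nonneg y) hyx hβ0.le
      nlinarith
    · have h3 := htail x y h1 hx hxy
      have h4 : 0 ≤ s * (|y| ^ β - |x| ^ β) :=
        mul_nonneg hs.le (sub_nonneg.2 (Real.rpow_le_rpow (abs_nonneg x) hxy hβ0.le))
      calc min (p x) (p y) * Real.exp (s * (|y| ^ β - |x| ^ β))
          ≤ p x * Real.exp (-(2 * s * (|y| ^ β - |x| ^ β))) *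
            Real.exp (s * (|y| ^ β - |x| ^ β)) := by
            gcongr; exact (min_le_right _ _).trans h3
        _ = p x * Real.exp (-(s * (|y| ^ β - |x| ^ β))) := by
            rw [mul_assoc, ← Real.exp_add]; congr 2; ring
        _ ≤ p x := mul_le_of_le_one_right hpx.le (Real.exp_le_one_iff.2 (by linarith))
  · have h3 : stepSize Ginv h x ≤ √(h * Γ) :=
      Real.sqrt_le_sqrt (mul_le_mul_of_nonneg_left (hΓ x (abs_le.1 hx)).2 hh.le)
    have h4 : |y| ≤ x₀ + √(h * Γ) := by
      have := abs_sub_abs_le_abs_sub y x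
      linarith
    have h5 := Real.rpow_le_rpow (abs_nonneg y) h4 hβ0.le
    have h6 : 0 ≤ |x| ^ β := by positivity
    rw [mul_comm B]
    refine mul_le_mul (min_le_left _ _) (Real.exp_le_exp.2 ?_) (Real.exp_pos _).le hpx.le
    nlinarith

/-- When `p` does not decrease along the move, its minimum is `p x`, and the truncated kernel loses
only the factor `1 + ε` through the larger step size. -/
theorem localFlow_inward_ge (hh : 0 < h) (hG0 : ∀ x, 0 < Ginv x) (hp0 : ∀ x, 0 < p x)
    {ε x y w : ℝ} (hε : 0 < ε) (hw : w = stepSize Ginv h x) (hxy : 0 < x * y) (hyx : |y - x| ≤ w)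
    (hyx' : |y - x| ≤ stepSize Ginv h y) (hwy : stepSize Ginv h y ≤ (1 + ε) * w)
    (hpy : p x ≤ p y) :
    densityAtOne * p x / ((1 + ε) * w) ≤ localFlow p Ginv h (x, y) := by
  have hw0 : 0 < w := hw ▸ stepSize_pos hh hG0 x
  have hcp := mul_pos densityAtOne_pos (hp0 x)
  rw [localFlow, if_pos ⟨hxy, by rw [← hw]; exact le_min hyx hyx'⟩]
  simp only
  rw [min_eq_left hpy, ← hw]
  have h1 : 0 < max w (stepSize Ginv h y) := lt_max_of_lt_left hw0
  refine div_le_div_of_nonneg_left hcp.le h1 (max_le ?_ hwy)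
  linarith [mul_pos hε hw0]

/-- The contributions to the drift of the two points at distance `t` from `x`. -/
theorem outward_add_inward_drift_ge (hh : 0 < h) (hG0 : ∀ x, 0 < Ginv x) (hp0 : ∀ x, 0 < p x)
    (hβ0 : 0 < β) (hβ1 : β ≤ 1) (hs : 0 < s) (htail : TailDecay p β s x₀)
    {ε η x y y' t w : ℝ} (hε : 0 < ε) (hε1 : ε < 1 / 2) (hη : 0 ≤ η) (hw : w = stepSize Ginv h x)
    (hwx : w ≤ |x| / 2)
    (hx : 2 * x₀ ≤ |x|) (ht : 0 ≤ t) (hxy : 0 < x * y) (hxy' : t ≤ w → 0 < x * y')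
    (hyx : |y - x| = t) (hyx' : |y' - x| = t) (hy : |y| = |x| + t) (hy' : t ≤ w → |y'| = |x| - t)
    (hosc : ∀ z, |z - x| ≤ w →
      (1 - ε) * w ≤ stepSize Ginv h z ∧ stepSize Ginv h z ≤ (1 + ε) * w)
    (hgrow : w / 2 ≤ t → η ≤ 1 - Real.exp (-(s * ((|x| + t) ^ β - |x| ^ β)))) :
    densityAtOne * p x / w * (η ^ 2 * ((if t ≤ (1 - ε) * w then 1 else 0) -
        (if t ≤ w / 2 then 1 else 0)) - ε * (if t ≤ w then 1 else 0) -
        ((if t ≤ w then 1 else 0) - (if t ≤ (1 - ε) * w then 1 else 0))) ≤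
      localFlow p Ginv h (x, y) * (1 - lyapunov β s y / lyapunov β s x) +
        localFlow p Ginv h (x, y') * (1 - lyapunov β s y' / lyapunov β s x) := by
  have hw0 : 0 < w := hw ▸ stepSize_pos hh hG0 x
  have hc := densityAtOne_pos
  have hpx := hp0 x
  have hA : 0 < densityAtOne * p x / w := by positivity
  have hεw : 0 < ε * w := by positivity
  rw [lyapunov_div, lyapunov_div]
  by_cases htw : t ≤ w
  swap
  · have hno : ∀ z, |z - x| = t → localFlow p Ginv h (x, z) = 0 := by
      intro z hz
      refine if_neg fun hc => htw ?_
      rw [← hz, hw]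
      exact hc.2.trans (min_le_left _ _)
    rw [hno y hyx, hno y' hyx', if_neg htw, if_neg (by linarith), if_neg (by linarith)]
    simp
  have hX : 0 < |x| := by linarith
  have hx0 : 0 ≤ |x| - t := by linarith
  rw [hy, hy' htw]
  set Δ := s * ((|x| + t) ^ β - |x| ^ β) with hΔ
  have hΔ0 : 0 ≤ Δ :=
    mul_nonneg hs.le (sub_nonneg.2 (Real.rpow_le_rpow (abs_nonneg x) (by linarith) hβ0.le))
  have hΔ' : s * ((|x| - t) ^ β - |x| ^ β) ≤ -Δ := by
    have := rpow_add_sub_le_sub_rpow_sub hβ0.le hβ1 ht (show t ≤ |x| by linarith)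
    nlinarith
  set e := Real.exp (-Δ) with he
  have he0 : 0 < e := Real.exp_pos _
  have he1 : e ≤ 1 := Real.exp_le_one_iff.2 (by linarith)
  -- the outward point
  have hout : -(densityAtOne * p x / w * ((1 - e) * e)) ≤
      localFlow p Ginv h (x, y) * (1 - Real.exp Δ) := by
    have hneg : 1 - Real.exp Δ ≤ 0 := by linarith [Real.one_le_exp hΔ0]
    have hpy : p y ≤ p x * (e * e) := by
      have := htail x y hxy (by linarith [abs_nonneg x]) (by linarith)
      rw [hy] at this
      refine this.trans_eq ?_
      rw [he, ← Real.exp_add, hΔ]; congr 2; ring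
    have hle : localFlow p Ginv h (x, y) ≤ densityAtOne * (p x * (e * e)) / w := by
      unfold localFlow
      split_ifs
      · gcongr
        · exact (min_le_right _ _).trans hpy
        · rw [hw]; exact le_max_left _ _
      · positivity
    have hee : e * Real.exp Δ = 1 := by rw [he, ← Real.exp_add]; simp
    have h1 := mul_le_mul_of_nonpos_right hle hneg
    refine le_trans (le_of_eq ?_) h1
    linear_combination (densityAtOne * p x / w * e) * hee
  -- the inward point
  have hin0 : 0 ≤ 1 - Real.exp (s * ((|x| - t) ^ β - |x| ^ β)) := by
    have := Real.exp_le_one_iff.2 (hΔ'.trans (neg_nonpos.2 hΔ0))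
    linarith
  have hin1 : 1 - e ≤ 1 - Real.exp (s * ((|x| - t) ^ β - |x| ^ β)) := by
    have := Real.exp_le_exp.2 hΔ'
    linarith
  have hin : 0 ≤ localFlow p Ginv h (x, y') * (1 - Real.exp (s * ((|x| - t) ^ β - |x| ^ β))) :=
    mul_nonneg (localFlow_nonneg hh hG0 hp0 _) hin0
  rw [if_pos htw]
  have hgg : (1 - e) * e ≤ 1 := by nlinarith
  by_cases htε : t ≤ (1 - ε) * w
  swap
  -- In the annulus `(1 - ε) * w < t ≤ w` the inward move may exceed the step size at `y'`. Its gain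
  -- is only known to be nonnegative, and the outward loss is at most `1`.
  · have : ε * w ≤ 1 / 2 * w := mul_le_mul_of_nonneg_right hε1.le hw0.le
    rw [if_neg htε, if_neg (by linarith)]
    have h1 := mul_nonneg hA.le (sub_nonneg.2 hgg)
    have h2 := mul_nonneg hA.le hε.le
    linear_combination h1 + h2 + hin + hout
  rw [if_pos htε]
  have hpy : p x ≤ p y' := by
    have := htail y' x (by rw [mul_comm]; exact hxy' htw) (by rw [hy' htw]; linarith)
      (by rw [hy' htw]; linarith)
    refine this.trans (mul_le_of_le_one_right (hp0 y').le (Real.exp_le_one_iff.2 ?_))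
    have := Real.rpow_le_rpow (abs_nonneg y') (show |y'| ≤ |x| by rw [hy' htw]; linarith) hβ0.le
    have := mul_nonneg hs.le (sub_nonneg.2 this)
    linarith
  have hosc' := hosc y' (by linarith)
  have hkey : densityAtOne * p x / w * (1 - e - ε) ≤
      localFlow p Ginv h (x, y') * (1 - Real.exp (s * ((|x| - t) ^ β - |x| ^ β))) := by
    have h1 := localFlow_inward_ge hh hG0 hp0 hε hw (hxy' htw) (by linarith)
      (by linarith [hosc'.1]) hosc'.2 hpy
    have h2 : (1 - e - ε) ≤ (1 - e) / (1 + ε) := by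
      rw [le_div_iff₀ (by linarith)]
      linarith [mul_nonneg he0.le hε.le, mul_self_nonneg ε,
        show (1 - e - ε) * (1 + ε) = 1 - e - (e * ε + ε * ε) by ring]
    calc densityAtOne * p x / w * (1 - e - ε) ≤ densityAtOne * p x / w * ((1 - e) / (1 + ε)) :=
          mul_le_mul_of_nonneg_left h2 hA.le
      _ = densityAtOne * p x / ((1 + ε) * w) * (1 - e) := by field_simp
      _ ≤ _ := mul_le_mul h1 hin1 (by linarith) (localFlow_nonneg hh hG0 hp0 _)
  -- Gain minus loss is `(1 - e) - e * (1 - e) = (1 - e)²`, up to the error `ε`.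
  have hη2 : η ^ 2 * (1 - if t ≤ w / 2 then 1 else 0) ≤ (1 - e) ^ 2 := by
    split_ifs with h2
    · rw [sub_self, mul_zero]
      exact sq_nonneg _
    · rw [sub_zero, mul_one]
      exact pow_le_pow_left₀ hη (hgrow (by linarith)) 2
  linear_combination hkey + hout + mul_le_mul_of_nonneg_left hη2 hA.le

theorem integral_ite_abs_le {b : ℝ} (hb : 0 ≤ b) :
    Integrable (fun u : ℝ => if |u| ≤ b then (1 : ℝ) else 0) ∧
      ∫ u : ℝ, (if |u| ≤ b then (1 : ℝ) else 0) = 2 * b := by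
  have e : (fun u : ℝ => if |u| ≤ b then (1 : ℝ) else 0) =
      (Set.Icc (-b) b).indicator fun _ => 1 := by
    funext u
    simp only [Set.indicator_apply, Set.mem_Icc, abs_le]
  rw [e]
  refine ⟨(integrable_indicator_iff measurableSet_Icc).2 (integrableOn_const (by simp)), ?_⟩
  rw [integral_indicator_const _ measurableSet_Icc]
  simp [Measure.real, Real.volume_Icc]
  rw [ENNReal.toReal_ofReal (by linarith)]
  ring

/-- The drift condition in the tails, for the local flow. -/
theorem drift_ge_of_tail (hh : 0 < h) (hp : Measurable p) (hG : Measurable Ginv)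
    (hG0 : ∀ x, 0 < Ginv x) (hp0 : ∀ x, 0 < p x)
    (hβ0 : 0 < β) (hβ1 : β ≤ 1) (hs : 0 < s) (hx₀ : 0 < x₀) (htail : TailDecay p β s x₀)
    {B : ℝ} (hB : ∀ x y, localFlow p Ginv h (x, y) * (lyapunov β s y / lyapunov β s x) ≤
      B * (p x * propDensity Ginv h x y))
    {η x w : ℝ} (hη : 0 < η) (hη1 : η ≤ 1) (hw : w = stepSize Ginv h x) (hwx : w ≤ |x| / 2)
    (hx : 2 * x₀ ≤ |x|)
    (hosc : ∀ z, |z - x| ≤ w →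
      (1 - η ^ 2 / 10) * w ≤ stepSize Ginv h z ∧ stepSize Ginv h z ≤ (1 + η ^ 2 / 10) * w)
    (hgrow : ∀ t, w / 2 ≤ t → η ≤ 1 - Real.exp (-(s * ((|x| + t) ^ β - |x| ^ β)))) :
    densityAtOne * η ^ 2 / 5 * p x ≤
      ∫ y, localFlow p Ginv h (x, y) * (1 - lyapunov β s y / lyapunov β s x) := by
  have hw0 : 0 < w := hw ▸ stepSize_pos hh hG0 x
  have hη2 : η ^ 2 ≤ 1 := by nlinarith
  have hη0 : 0 < η ^ 2 := by positivity
  set ε := η ^ 2 / 10 with hε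
  set F : ℝ → ℝ := fun y => localFlow p Ginv h (x, y) * (1 - lyapunov β s y / lyapunov β s x)
    with hF
  have hFi : Integrable F := by
    have hq : Integrable (fun y => p x * propDensity Ginv h x y) :=
      (integrable_gaussianPDFReal _ _).const_mul _
    have hm : Measurable fun y => localFlow p Ginv h (x, y) :=
      (measurable_localFlow hp hG).comp measurable_prodMk_left
    have i1 : Integrable fun y => localFlow p Ginv h (x, y) :=
      hq.mono' hm.aestronglyMeasurable (ae_of_all _ fun y => by
        rw [Real.norm_of_nonneg (localFlow_nonneg hh hG0 hp0 _)]
        exact localFlow_le_mul_propDensity hh hG0 hp0 x y)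
    have i2 : Integrable fun y => localFlow p Ginv h (x, y) *
        (lyapunov β s y / lyapunov β s x) :=
      (hq.const_mul B).mono'
        (hm.mul ((measurable_lyapunov β s).div_const _)).aestronglyMeasurable
        (ae_of_all _ fun y => by
          rw [Real.norm_of_nonneg (mul_nonneg (localFlow_nonneg hh hG0 hp0 _)
            (div_pos (lyapunov_pos _ _ _) (lyapunov_pos _ _ _)).le)]
          exact hB x y)
    exact (i1.sub i2).congr (ae_of_all _ fun y => by simp [hF, mul_sub])
  have hx0 : x ≠ 0 := fun h0 => by rw [h0, abs_zero] at hx; linarith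
  have i₁ := integral_ite_abs_le (b := (1 - ε) * w) (by rw [hε]; nlinarith)
  have i₂ := integral_ite_abs_le (b := w / 2) (by linarith)
  have i₃ := integral_ite_abs_le (b := w) hw0.le
  set I₁ : ℝ → ℝ := fun u => if |u| ≤ (1 - ε) * w then 1 else 0 with hI₁
  set I₂ : ℝ → ℝ := fun u => if |u| ≤ w / 2 then 1 else 0 with hI₂
  set I₃ : ℝ → ℝ := fun u => if |u| ≤ w then 1 else 0 with hI₃
  -- Folding the integral about `x` pairs each outward move with its inward mirror image; the sign
  -- of `x * u` decides which of `x ± u` is outward.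
  have hpt : ∀ u, densityAtOne * p x / w *
      (η ^ 2 * (I₁ u - I₂ u) - ε * I₃ u - (I₃ u - I₁ u)) ≤ F (x + u) + F (x - u) := by
    intro u
    have key := fun y y' hxy hxy' hyx hyx' hy hy' =>
      outward_add_inward_drift_ge hh hG0 hp0 hβ0 hβ1 hs htail (ε := ε) (t := |u|)
        (y := y) (y' := y') (by positivity) (by rw [hε]; linarith) hη.le hw hwx hx (abs_nonneg u)
        hxy hxy' hyx hyx' hy hy' hosc (hgrow _)
    rcases lt_or_gt_of_ne hx0 with hneg | hpos <;> rcases le_total 0 u with hu | hu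
    · rw [add_comm]
      rw [abs_of_neg hneg] at hwx
      refine key (x - u) (x + u) (by nlinarith) (fun h => ?_) (by simp) (by simp) ?_ fun h => ?_
      · rw [abs_of_nonneg hu] at h
        nlinarith
      · rw [abs_of_neg hneg, abs_of_nonneg hu, abs_of_neg (by linarith)]; ring
      · rw [abs_of_nonneg hu] at h ⊢
        rw [abs_of_neg hneg, abs_of_neg (by linarith)]; ring
    · rw [abs_of_neg hneg] at hwx
      refine key (x + u) (x - u) (by nlinarith) (fun h => ?_) (by simp) (by simp) ?_ fun h => ?_
      · rw [abs_of_nonpos hu] at h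
        nlinarith
      · rw [abs_of_neg hneg, abs_of_nonpos hu, abs_of_neg (by linarith)]; ring
      · rw [abs_of_nonpos hu] at h ⊢
        rw [abs_of_neg hneg, abs_of_neg (by linarith)]; ring
    · rw [abs_of_pos hpos] at hwx
      refine key (x + u) (x - u) (by nlinarith) (fun h => ?_) (by simp) (by simp) ?_ fun h => ?_
      · rw [abs_of_nonneg hu] at h
        nlinarith
      · rw [abs_of_pos hpos, abs_of_nonneg hu, abs_of_pos (by linarith)]
      · rw [abs_of_nonneg hu] at h ⊢
        rw [abs_of_pos hpos, abs_of_pos (by linarith)]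
    · rw [add_comm]
      rw [abs_of_pos hpos] at hwx
      refine key (x - u) (x + u) (by nlinarith) (fun h => ?_) (by simp) (by simp) ?_ fun h => ?_
      · rw [abs_of_nonpos hu] at h
        nlinarith
      · rw [abs_of_pos hpos, abs_of_nonpos hu, abs_of_pos (by linarith)]; ring
      · rw [abs_of_nonpos hu] at h ⊢
        rw [abs_of_pos hpos, abs_of_pos (by linarith)]; ring
  have hF1 : ∫ u, F (x + u) = ∫ y, F y := integral_add_left_eq_self F x
  have hF2 : ∫ u, F (x - u) = ∫ y, F y := integral_sub_left_eq_self F volume x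
  have j1 : Integrable fun u => F (x + u) := hFi.comp_add_left x
  have j2 : Integrable fun u => F (x - u) := hFi.comp_sub_left x
  have j3 : Integrable fun u => η ^ 2 * (I₁ u - I₂ u) - ε * I₃ u - (I₃ u - I₁ u) :=
    (((i₁.1.sub i₂.1).const_mul _).sub (i₃.1.const_mul _)).sub (i₃.1.sub i₁.1)
  have hmono := integral_mono (j3.const_mul (densityAtOne * p x / w)) (j1.add j2) hpt
  have j4 : ∫ u, (η ^ 2 * (I₁ u - I₂ u) - ε * I₃ u - (I₃ u - I₁ u)) =
      2 * w * (η ^ 2 * (1 / 2 - ε) - 2 * ε) := by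
    have : ∀ u, η ^ 2 * (I₁ u - I₂ u) - ε * I₃ u - (I₃ u - I₁ u) =
        (η ^ 2 + 1) * I₁ u + ((-η ^ 2) * I₂ u + (-(ε + 1)) * I₃ u) := fun u => by ring
    simp_rw [this]
    rw [integral_add_mul_add_mul (i₁.1.const_mul _) i₂.1 i₃.1, integral_const_mul, i₁.2, i₂.2, i₃.2]
    ring
  have j5 : ∫ u, ((fun u => F (x + u)) + fun u => F (x - u)) u = 2 * ∫ y, F y := by
    simp only [Pi.add_apply]
    rw [integral_add j1 j2, hF1, hF2]; ring
  rw [integral_const_mul, j4, j5] at hmono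
  have e1 : densityAtOne * p x / w * (2 * w * (η ^ 2 * (1 / 2 - ε) - 2 * ε)) =
      2 * (densityAtOne * p x) * (η ^ 2 * (1 / 2 - ε) - 2 * ε) := by field_simp
  rw [e1] at hmono
  have hcp : 0 < densityAtOne * p x := mul_pos densityAtOne_pos (hp0 x)
  -- Since `η² ≤ 1` and `ε = η² / 10`, the right side is at least `η² * (1/2 - 1/10 - 1/5)`.
  have h8 : η ^ 2 / 5 ≤ η ^ 2 * (1 / 2 - ε) - 2 * ε := by rw [hε]; nlinarith
  nlinarith [mul_le_mul_of_nonneg_left h8 hcp.le]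

end Drift

/-! ### Tail and compact estimates, and the general theorem -/

section Main

theorem exists_forall_le_abs_of_eventually_cocompact {q : ℝ → Prop}
    (hq : ∀ᶠ x in cocompact ℝ, q x) : ∃ R : ℝ, ∀ x, R ≤ |x| → q x := by
  rw [← Metric.cobounded_eq_cocompact, hasBasis_cobounded_norm.eventually_iff] at hq
  obtain ⟨R, -, hR⟩ := hq
  exact ⟨R, fun x hx => hR hx⟩

theorem eventually_cocompact_le_abs (R : ℝ) : ∀ᶠ x in cocompact ℝ, R ≤ |x| := by
  rw [← Metric.cobounded_eq_cocompact]
  exact hasBasis_cobounded_norm.mem_of_mem (i := R) trivial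

variable {p Ginv : ℝ → ℝ} {h β s x₀ : ℝ}

/-- A square root does not enlarge the relative error: `(1 - ε)² ≤ 1 - ε` and `1 + ε ≤ (1 + ε)²`. -/
theorem stepSize_mem_of_abs_div_sub_one_le (hh : 0 < h) (hG0 : ∀ x, 0 < Ginv x) {x z ε : ℝ}
    (hε : 0 ≤ ε) (hε1 : ε ≤ 1) (hz : |Ginv z / Ginv x - 1| ≤ ε) :
    (1 - ε) * stepSize Ginv h x ≤ stepSize Ginv h z ∧
      stepSize Ginv h z ≤ (1 + ε) * stepSize Ginv h x := by
  have hGx := hG0 x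
  have hw := stepSize_pos hh hG0 x
  have hw2 : stepSize Ginv h x ^ 2 = h * Ginv x := Real.sq_sqrt (mul_pos hh hGx).le
  obtain ⟨h1, h2⟩ := abs_le.1 hz
  have h3 : (1 - ε) * Ginv x ≤ Ginv z := by
    rw [← le_div_iff₀ hGx]; linarith
  have h4 : Ginv z ≤ (1 + ε) * Ginv x := by
    rw [← div_le_iff₀ hGx]; linarith
  have hhx := mul_pos hh hGx
  constructor
  · refine Real.le_sqrt_of_sq_le ?_
    rw [mul_pow, hw2]
    have h5 : (1 - ε) ^ 2 ≤ 1 - ε := by nlinarith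
    calc (1 - ε) ^ 2 * (h * Ginv x) ≤ (1 - ε) * (h * Ginv x) := by gcongr
      _ = h * ((1 - ε) * Ginv x) := by ring
      _ ≤ h * Ginv z := by gcongr
  · refine Real.sqrt_le_iff.2 ⟨by positivity, ?_⟩
    rw [mul_pow, hw2]
    have h5 : 1 + ε ≤ (1 + ε) ^ 2 := by nlinarith
    calc h * Ginv z ≤ h * ((1 + ε) * Ginv x) := by gcongr
      _ = (1 + ε) * (h * Ginv x) := by ring
      _ ≤ (1 + ε) ^ 2 * (h * Ginv x) := by gcongr

/-- The origin of the exponent `2(1 - β)`: the step is at least of order `|x|^(1-β)` and the slope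
of `|x|^β` is of order `|x|^(β-1)`, so `log V` grows by a fixed amount over half a step. -/
theorem mul_le_rpow_growth_of_stepSize_le (hh : 0 < h) (hβ0 : 0 < β) (hβ1 : β ≤ 1) (hs : 0 < s)
    {c x t : ℝ} (hc : 0 < c) (hx : x ≠ 0) (hG : c * |x| ^ (2 * (1 - β)) ≤ Ginv x)
    (hwx : stepSize Ginv h x ≤ |x|) (ht : stepSize Ginv h x / 2 ≤ t) :
    s * (β * 2 ^ (β - 1) * √(h * c) / 2) ≤ s * ((|x| + t) ^ β - |x| ^ β) := by
  have hX : 0 < |x| := abs_pos.2 hx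
  set w := stepSize Ginv h x with hw
  have hw0 : 0 ≤ w := Real.sqrt_nonneg _
  have h1 : √(h * c) * |x| ^ (1 - β) ≤ w := by
    refine Real.le_sqrt_of_sq_le ?_
    rw [mul_pow, Real.sq_sqrt (by positivity), ← Real.rpow_natCast, ← Real.rpow_mul hX.le]
    calc h * c * |x| ^ ((1 - β) * (2 : ℕ)) = h * (c * |x| ^ (2 * (1 - β))) := by
          rw [mul_assoc]; push_cast; rw [mul_comm (1 - β)]
      _ ≤ _ := by gcongr
  have h2 := mul_le_rpow_add_sub hβ0 hβ1 hX (show 0 ≤ w / 2 by linarith)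
    (show w / 2 ≤ |x| by linarith)
  have h3 : (|x| + w / 2) ^ β ≤ (|x| + t) ^ β :=
    Real.rpow_le_rpow (by positivity) (by linarith) hβ0.le
  refine mul_le_mul_of_nonneg_left ?_ hs.le
  have h4 : |x| ^ (β - 1) * |x| ^ (1 - β) = 1 := by
    rw [← Real.rpow_add hX]; simp
  calc β * 2 ^ (β - 1) * √(h * c) / 2
      = β * (2 * |x|) ^ (β - 1) * (√(h * c) * |x| ^ (1 - β) / 2) := by
        rw [Real.mul_rpow (by norm_num) hX.le]
        linear_combination (-(β * 2 ^ (β - 1) * √(h * c) / 2)) * h4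
    _ ≤ β * (2 * |x|) ^ (β - 1) * (w / 2) := by gcongr
    _ ≤ _ := by linarith

/-- The drift condition outside a compact interval, for the local flow. -/
theorem exists_drift (hh : 0 < h) (hp : Measurable p) (hG : Measurable Ginv)
    (hG0 : ∀ x, 0 < Ginv x) (hp0 : ∀ x, 0 < p x)
    (hβ0 : 0 < β) (hβ1 : β ≤ 1) (hs : 0 < s) (hx₀ : 0 < x₀) (htail : TailDecay p β s x₀)
    (hosc : NonOscillatingTails Ginv) (ho : Ginv =o[cocompact ℝ] (fun x : ℝ => |x| ^ 2))
    (hlow : ∃ c : ℝ, 0 < c ∧ ∀ᶠ x in cocompact ℝ, c * |x| ^ (2 * (1 - β)) ≤ Ginv x)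
    {B : ℝ} (hB : ∀ x y, localFlow p Ginv h (x, y) * (lyapunov β s y / lyapunov β s x) ≤
      B * (p x * propDensity Ginv h x y)) :
    ∃ R θ : ℝ, 0 < R ∧ 0 < θ ∧ ∀ x ∉ Set.Icc (-R) R, θ * p x ≤
      ∫ y, localFlow p Ginv h (x, y) * (1 - lyapunov β s y / lyapunov β s x) := by
  obtain ⟨c, hc, hlow⟩ := hlow
  obtain ⟨R₁, hR₁⟩ := exists_forall_le_abs_of_eventually_cocompact hlow
  set κ := s * (β * 2 ^ (β - 1) * √(h * c) / 2) with hκ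
  have hκ0 : 0 < κ := by positivity
  set η := 1 - Real.exp (-κ) with hη
  have hη0 : 0 < η := by
    have : Real.exp (-κ) < Real.exp 0 := Real.exp_lt_exp.2 (by linarith)
    rw [Real.exp_zero] at this
    linarith
  have hη1 : η ≤ 1 := by linarith [Real.exp_pos (-κ)]
  obtain ⟨δ, R₂, hδ, hR₂, hosc⟩ := hosc (η ^ 2 / 10) (by positivity)
  have hd : 0 < min δ (1 / 2) := lt_min hδ (by norm_num)
  -- The constant is chosen so that `w ≤ min δ (1/2) * |x|`: a step then stays where `Ginv` is
  -- nearly constant and does not cross the origin.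
  obtain ⟨R₃, hR₃⟩ := exists_forall_le_abs_of_eventually_cocompact
    (ho.def (c := min δ (1 / 2) ^ 2 / h) (by positivity))
  set R := max 1 (max (2 * x₀) (max R₁ (max R₂ R₃))) with hR
  refine ⟨R, densityAtOne * η ^ 2 / 5, lt_max_of_lt_left one_pos,
    by have := densityAtOne_pos; positivity, fun x hx => ?_⟩
  have hRx : R ≤ |x| := by
    by_contra! hlt
    exact hx (abs_le.1 hlt.le)
  simp only [hR, max_le_iff] at hRx
  obtain ⟨hx1, hx2, hx3, hx4, hx5⟩ := hRx
  have hX : 0 < |x| := by linarith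
  have hw : stepSize Ginv h x ≤ min δ (1 / 2) * |x| := by
    refine Real.sqrt_le_iff.2 ⟨by positivity, ?_⟩
    have := hR₃ x hx5
    rw [Real.norm_of_nonneg (hG0 x).le, Real.norm_of_nonneg (by positivity), div_mul_eq_mul_div,
      le_div_iff₀ hh] at this
    rw [mul_pow]
    linarith
  have hw1 : stepSize Ginv h x ≤ |x| / 2 := by
    have := mul_le_mul_of_nonneg_right (min_le_right δ (1 / 2)) hX.le
    linarith
  have hw2 : stepSize Ginv h x ≤ δ * |x| :=
    hw.trans (mul_le_mul_of_nonneg_right (min_le_left _ _) hX.le)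
  refine drift_ge_of_tail hh hp hG hG0 hp0 hβ0 hβ1 hs hx₀ htail hB hη0 hη1 rfl hw1 hx2
    (fun z hz => stepSize_mem_of_abs_div_sub_one_le hh hG0 (by positivity) (by nlinarith)
      (hosc x z hx4 (hz.trans hw2))) fun t ht => ?_
  have := mul_le_rpow_growth_of_stepSize_le hh hβ0 hβ1 hs hc (abs_pos.1 hX) (hR₁ x hx3)
    (by linarith) ht
  rw [hη]
  gcongr

theorem exists_flow_ge (hh : 0 < h) (hpc : BoundedAwayOnCompacts p)
    (hGc : BoundedAwayOnCompacts Ginv) {R : ℝ} :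
    ∃ m : ℝ, 0 < m ∧ ∀ x ∈ Set.Icc (-R) R, ∀ y ∈ Set.Icc (-R) R, m ≤ flow p Ginv h (x, y) := by
  obtain ⟨a, A, ha, hA⟩ := hpc (Set.Icc (-R) R) isCompact_Icc
  obtain ⟨g, Γ, hg, hΓ⟩ := hGc (Set.Icc (-R) R) isCompact_Icc
  have hG0 := hGc.pos
  rcases lt_or_ge R 0 with hR | hR
  · exact ⟨1, one_pos, fun x hx => absurd (hx.1.trans hx.2) (by linarith)⟩
  have hΓ0 : 0 < Γ := (hG0 0).trans_le (hΓ 0 ⟨by linarith, hR⟩).2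
  have := Real.pi_pos
  set d := (√(2 * Real.pi))⁻¹ * (√(h * Γ))⁻¹ * Real.exp (-(2 * R) ^ 2 / (2 * (h * g))) with hd
  have hd0 : 0 < d := by positivity
  have key : ∀ x ∈ Set.Icc (-R) R, ∀ y ∈ Set.Icc (-R) R, a * d ≤ p x * propDensity Ginv h x y := by
    intro x hx y hy
    have hw := stepSize_pos hh hG0 x
    refine mul_le_mul (hA x hx).1 ?_ hd0.le (ha.le.trans (hA x hx).1)
    have hw2 : stepSize Ginv h x ^ 2 = h * Ginv x := Real.sq_sqrt (mul_pos hh (hG0 x)).le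
    rw [propDensity_eq hh hG0, hd, hw2]
    have h1 : stepSize Ginv h x ≤ √(h * Γ) :=
      Real.sqrt_le_sqrt (mul_le_mul_of_nonneg_left (hΓ x hx).2 hh.le)
    have h2 : (y - x) ^ 2 ≤ (2 * R) ^ 2 :=
      sq_le_sq' (by linarith [hx.2, hy.1]) (by linarith [hx.1, hy.2])
    have h3 : g ≤ Ginv x := (hΓ x hx).1
    have h4 := hG0 x
    have h5 : (y - x) ^ 2 / (2 * (h * Ginv x)) ≤ (2 * R) ^ 2 / (2 * (h * g)) := by gcongr
    have h6 : -(2 * R) ^ 2 / (2 * (h * g)) ≤ -(y - x) ^ 2 / (2 * (h * Ginv x)) := by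
      rw [neg_div, neg_div]
      exact neg_le_neg h5
    exact mul_le_mul (by gcongr) (Real.exp_le_exp.2 h6) (Real.exp_pos _).le (by positivity)
  exact ⟨a * d, by positivity, fun x hx y hy => le_min (key x hx y hy) (key y hy x hx)⟩

/-- A Gaussian density is bounded by its inverse standard deviation, and `2 * (1 - β) ≥ 0` keeps
`Ginv` away from `0` in the tails. -/
theorem exists_propDensity_le (hh : 0 < h) (hGc : BoundedAwayOnCompacts Ginv) (hβ1 : β ≤ 1)
    (hlow : ∃ c : ℝ, 0 < c ∧ ∀ᶠ x in cocompact ℝ, c * |x| ^ (2 * (1 - β)) ≤ Ginv x) :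
    ∃ D : ℝ, ∀ x y, propDensity Ginv h x y ≤ D := by
  obtain ⟨c, hc, hlow⟩ := hlow
  obtain ⟨R, hR⟩ := exists_forall_le_abs_of_eventually_cocompact hlow
  obtain ⟨g, Γ, hg, hΓ⟩ := hGc (Set.Icc (-max R 1) (max R 1)) isCompact_Icc
  have hm : 0 < min c g := lt_min hc hg
  have hlb : ∀ x, min c g ≤ Ginv x := by
    intro x
    rcases le_total (max R 1) |x| with hx | hx
    · have h1 : 1 ≤ |x| ^ (2 * (1 - β)) :=
        Real.one_le_rpow ((le_max_right _ _).trans hx) (by linarith)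
      have h2 := hR x ((le_max_left _ _).trans hx)
      exact (min_le_left _ _).trans ((le_mul_of_one_le_right hc.le h1).trans h2)
    · exact (min_le_right _ _).trans (hΓ x (abs_le.1 hx)).1
  refine ⟨(√(2 * Real.pi))⁻¹ * (√(h * min c g))⁻¹, fun x y =>
    (propDensity_le hh hGc.pos x y).trans ?_⟩
  have := Real.pi_pos
  have h1 : √(h * min c g) ≤ stepSize Ginv h x :=
    Real.sqrt_le_sqrt (mul_le_mul_of_nonneg_left (hlb x) hh.le)
  gcongr

/-- Geometric ergodicity when the target has tails `exp (-2 s |x| ^ β)` or lighter and the proposal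
standard deviation is at least of order `|x| ^ (1 - β)`. -/
theorem geometricallyErgodic_chain (hh : 0 < h) (hp : Measurable p) (hG : Measurable Ginv)
    [IsProbabilityMeasure (target p)] (hpc : BoundedAwayOnCompacts p)
    (hGc : BoundedAwayOnCompacts Ginv)
    (hβ0 : 0 < β) (hβ1 : β ≤ 1) (hs : 0 < s) (hx₀ : 0 < x₀) (htail : TailDecay p β s x₀)
    (hosc : NonOscillatingTails Ginv) (ho : Ginv =o[cocompact ℝ] (fun x : ℝ => |x| ^ 2))
    (hlow : ∃ c : ℝ, 0 < c ∧ ∀ᶠ x in cocompact ℝ, c * |x| ^ (2 * (1 - β)) ≤ Ginv x) :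
    GeometricallyErgodic (chain p Ginv h hp hG) (target p) := by
  have hG0 := hGc.pos
  have hp0 := hpc.pos
  have hpi : Integrable p := integrable_of_isProbabilityMeasure_target hp hp0
  obtain ⟨B, hB0, hB⟩ := exists_localFlow_mul_lyapunov_le hh hG0 hp0 hGc hβ0 hs hx₀ htail
  obtain ⟨R, θ, hR, hθ, hdrift⟩ :=
    exists_drift hh hp hG hG0 hp0 hβ0 hβ1 hs hx₀ htail hosc ho hlow hB
  obtain ⟨m, hm, hkm⟩ := exists_flow_ge hh hpc hGc (R := R)
  obtain ⟨D, hD⟩ := exists_propDensity_le hh hGc hβ1 hlow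
  obtain ⟨a, MC, ha, hMC⟩ := hpc (Set.Icc (-R) R) isCompact_Icc
  have hMC0 : 0 < MC := (hp0 0).trans_le (hMC 0 ⟨by linarith, hR.le⟩).2
  have hvol : volume (Set.Icc (-R) R) ≠ 0 := by
    simp only [Real.volume_Icc, ne_eq, ENNReal.ofReal_eq_zero, not_le]; linarith
  have hvol' : volume (Set.Icc (-R) R) ≠ ∞ := by simp
  have hq : ∀ x, Integrable fun y => p x * propDensity Ginv h x y := fun x =>
    (integrable_gaussianPDFReal x (propVar Ginv h x)).const_mul _
  have hL0 : ∀ x y, 0 < lyapunov β s y / lyapunov β s x := fun x y =>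
    div_pos (lyapunov_pos _ _ _) (lyapunov_pos _ _ _)
  have hκm := measurable_localFlow (h := h) hp hG
  have hLm := measurable_lyapunov β s
  have hκx : ∀ x, Integrable fun y => localFlow p Ginv h (x, y) := fun x =>
    (hq x).mono' (hκm.comp measurable_prodMk_left).aestronglyMeasurable (ae_of_all _ fun y => by
      rw [Real.norm_of_nonneg (localFlow_nonneg hh hG0 hp0 _)]
      exact localFlow_le_mul_propDensity hh hG0 hp0 x y)
  have hκVx : ∀ x, Integrable fun y =>
      localFlow p Ginv h (x, y) * (lyapunov β s y / lyapunov β s x) := fun x =>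
    ((hq x).const_mul B).mono' ((hκm.comp measurable_prodMk_left).mul
      (hLm.div_const _)).aestronglyMeasurable (ae_of_all _ fun y => by
        rw [Real.norm_of_nonneg (mul_nonneg (localFlow_nonneg hh hG0 hp0 _) (hL0 x y).le)]
        exact hB x y)
  have hsplit : ∀ x, ∫ y, localFlow p Ginv h (x, y) * (1 - lyapunov β s y / lyapunov β s x) =
      (∫ y, localFlow p Ginv h (x, y)) -
        ∫ y, localFlow p Ginv h (x, y) * (lyapunov β s y / lyapunov β s x) := fun x => by
    rw [← integral_sub (hκx x) (hκVx x)]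
    simp only [mul_sub, mul_one]
  obtain ⟨K, hK1, hK⟩ := exists_integral_sq_le_dirichlet (μ := volume) (k := flow p Ginv h)
    (κ := localFlow p Ginv h) (V := lyapunov β s) (C := Set.Icc (-R) R) (fun x => (hp0 x).le) hpi
    (integrable_flow hh hp hG hG0 hp0 hpi) hκm (localFlow_nonneg hh hG0 hp0)
    (localFlow_le_flow hh hG0 hp0) localFlow_swap (lyapunov_pos β s)
    (((integrable_mul_propDensity hh hp hG hG0 hp0 hpi).const_mul B).mono'
      (hκm.mul ((hLm.comp measurable_snd).div (hLm.comp measurable_fst))).aestronglyMeasurable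
      (ae_of_all _ fun z => by
        rw [Real.norm_of_nonneg (mul_nonneg (localFlow_nonneg hh hG0 hp0 _) (hL0 _ _).le)]
        exact hB z.1 z.2))
    measurableSet_Icc hvol hvol' hm hkm (fun x hx => (hMC x hx).2) hθ hB0 hdrift
    (fun x _ => by
      have h1 : ∫ y, localFlow p Ginv h (x, y) * (lyapunov β s y / lyapunov β s x) ≤
          ∫ y, B * (p x * propDensity Ginv h x y) :=
        integral_mono (hκVx x) ((hq x).const_mul B) (hB x)
      rw [integral_const_mul, integral_const_mul, integral_propDensity hh hG0] at h1
      have h2 : 0 ≤ ∫ y, localFlow p Ginv h (x, y) :=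
        integral_nonneg fun y => localFlow_nonneg hh hG0 hp0 _
      rw [hsplit]
      linarith)
  -- Acceptance is bounded below by the minorization on the interval and by the drift itself outside
  -- it, since dropping the term in `V(y)/V(x)` only increases the integral.
  refine geometricallyErgodic_chain_of_poincare hh hp hG hG0 hp0 (C := Set.Icc (-R) R)
    (K := K) (D := D) (θ := min θ (m * (2 * R) / MC)) hvol hvol' hK1 hK hD
    (lt_min hθ (by positivity)) fun x => ?_
  have hfx := integrable_flow_right (h := h) hp hG hp0 x
  by_cases hx : x ∈ Set.Icc (-R) R
  · calc min θ (m * (2 * R) / MC) * p x ≤ m * (2 * R) / MC * MC :=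
          mul_le_mul (min_le_right _ _) (hMC x hx).2 (hp0 x).le (by positivity)
      _ = ∫ _ in Set.Icc (-R) R, m := by
          rw [setIntegral_const, Measure.real, Real.volume_Icc,
            ENNReal.toReal_ofReal (by linarith), smul_eq_mul]
          field_simp
          ring
      _ ≤ ∫ y in Set.Icc (-R) R, flow p Ginv h (x, y) :=
          setIntegral_mono_on (integrableOn_const (by simp)) hfx.integrableOn measurableSet_Icc
            fun y hy => hkm x hx y hy
      _ ≤ ∫ y, flow p Ginv h (x, y) :=
          setIntegral_le_integral hfx (ae_of_all _ fun y => flow_nonneg hp0 _)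
  · have h1 : 0 ≤ ∫ y, localFlow p Ginv h (x, y) * (lyapunov β s y / lyapunov β s x) :=
      integral_nonneg fun y => mul_nonneg (localFlow_nonneg hh hG0 hp0 _) (hL0 x y).le
    have h2 := hdrift x hx
    rw [hsplit] at h2
    have h3 : ∫ y, localFlow p Ginv h (x, y) ≤ ∫ y, flow p Ginv h (x, y) :=
      integral_mono (hκx x) hfx fun y => localFlow_le_flow hh hG0 hp0 _
    have h4 := mul_le_mul_of_nonneg_right (min_le_left θ (m * (2 * R) / MC)) (hp0 x).le
    linarith

/-! ### The two classes of targets and regular growth of `Ginv` -/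

/-- The rate is halved because `V` may grow at only half the decay rate of the target. -/
theorem tailDecay_of_two_sided (hp0 : ∀ x, 0 < p x) {a : ℝ}
    (hr : ∀ x y, x₀ ≤ x → x ≤ y → p y / p x ≤ Real.exp (-a * (|y| ^ β - |x| ^ β)))
    (hl : ∀ x y, x ≤ -x₀ → y ≤ x → p y / p x ≤ Real.exp (-a * (|y| ^ β - |x| ^ β))) :
    TailDecay p β (a / 2) x₀ := by
  intro x y hxy hx hyx
  have key : p y / p x ≤ Real.exp (-a * (|y| ^ β - |x| ^ β)) := by
    rcases lt_or_ge 0 x with h0 | h0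
    · have hy0 : 0 < y := (mul_pos_iff_of_pos_left h0).1 hxy
      rw [abs_of_pos h0] at hx
      exact hr x y hx (by rwa [abs_of_pos h0, abs_of_pos hy0] at hyx)
    · have h0' : x < 0 := lt_of_le_of_ne h0 fun h => by simp [h] at hxy
      have hy0 : y < 0 := by
        by_contra! hy
        nlinarith [mul_nonpos_of_nonpos_of_nonneg h0 hy]
      rw [abs_of_neg h0'] at hx
      refine hl x y (by linarith) ?_
      rw [abs_of_neg h0', abs_of_neg hy0] at hyx
      linarith
  rw [div_le_iff₀ (hp0 x)] at key
  refine key.trans_eq ?_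
  rw [mul_comm]
  congr 2
  ring

/-- The ratio `f y / f x` is a function of `f y / |y| ^ γ`, `f x / |x| ^ γ` and `|y| / |x|` that is
continuous with value `1` at `(C, C, 1)`. -/
theorem ThetaAtInfinity.nonOscillatingTails {f : ℝ → ℝ} {γ : ℝ}
    (hf : ThetaAtInfinity f fun x => |x| ^ γ) : NonOscillatingTails f := by
  obtain ⟨C, hC, hlim⟩ := hf
  intro ε hε
  have hcont : ContinuousAt (fun q : ℝ × ℝ × ℝ => q.1 / q.2.1 * q.2.2 ^ γ) (C, C, 1) :=
    ContinuousAt.mul (ContinuousAt.div (by fun_prop) (by fun_prop) hC.ne')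
      (ContinuousAt.rpow_const (by fun_prop) (Or.inl one_ne_zero))
  obtain ⟨δ, hδ, H⟩ := Metric.continuousAt_iff.1 hcont ε hε
  obtain ⟨R, hR⟩ := exists_forall_le_abs_of_eventually_cocompact
    (hlim.eventually (Metric.ball_mem_nhds C hδ))
  refine ⟨min (δ / 2) (1 / 2), max 1 (2 * R), by positivity, by positivity, fun x y hx hyx => ?_⟩
  have hx1 : 1 ≤ |x| := (le_max_left _ _).trans hx
  have hx2 : 2 * R ≤ |x| := (le_max_right _ _).trans hx
  have hX : 0 < |x| := by linarith
  have h1 : |y - x| ≤ 1 / 2 * |x| :=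
    hyx.trans (mul_le_mul_of_nonneg_right (min_le_right _ _) hX.le)
  have h2 : |y - x| ≤ δ / 2 * |x| :=
    hyx.trans (mul_le_mul_of_nonneg_right (min_le_left _ _) hX.le)
  have h3 : |(|y| - |x|)| ≤ |y - x| := abs_abs_sub_abs_le_abs_sub y x
  have hY : 1 / 2 * |x| ≤ |y| := by linarith [(abs_le.1 h3).1]
  have hY0 : 0 < |y| := by linarith
  have hr : |(|y| / |x|) - 1| < δ := by
    have : |y| / |x| - 1 = (|y| - |x|) / |x| := by field_simp
    rw [this, abs_div, abs_abs, div_lt_iff₀ hX]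
    nlinarith
  have hdist := H (x := (f y / |y| ^ γ, f x / |x| ^ γ, |y| / |x|)) (by
    rw [Prod.dist_eq, Prod.dist_eq]
    refine max_lt (hR y (by linarith)) (max_lt (hR x ?_) hr)
    rcases le_total 0 R with h0 | h0 <;> linarith)
  simp only [Real.one_rpow, mul_one, div_self hC.ne', Real.dist_eq] at hdist
  have e : f y / |y| ^ γ / (f x / |x| ^ γ) * (|y| / |x|) ^ γ = f y / f x := by
    rw [Real.div_rpow hY0.le hX.le]
    have := (Real.rpow_pos_of_pos hX γ).ne'
    have := (Real.rpow_pos_of_pos hY0 γ).ne'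
    field_simp
  rw [e] at hdist
  exact hdist.le

theorem ThetaAtInfinity.isLittleO_sq {f : ℝ → ℝ} {γ : ℝ} (hγ : γ < 2)
    (hf : ThetaAtInfinity f fun x => |x| ^ γ) : f =o[cocompact ℝ] (fun x : ℝ => |x| ^ 2) := by
  obtain ⟨C, hC, hlim⟩ := hf
  have habs : Tendsto (fun x : ℝ => |x|) (cocompact ℝ) atTop :=
    tendsto_norm_cocompact_atTop (E := ℝ)
  have h1 : Tendsto (fun x : ℝ => f x / |x| ^ γ * |x| ^ (-(2 - γ))) (cocompact ℝ) (𝓝 (C * 0)) :=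
    hlim.mul ((tendsto_rpow_neg_atTop (by linarith)).comp habs)
  rw [mul_zero] at h1
  refine (isLittleO_iff_tendsto' ?_).2 (h1.congr' ?_)
  · filter_upwards [eventually_cocompact_le_abs 1] with x hx h0
    have : 0 < |x| ^ 2 := by positivity
    exact absurd h0 this.ne'
  · filter_upwards [eventually_cocompact_le_abs 1] with x hx
    have hX : 0 < |x| := by linarith
    rw [neg_sub, Real.rpow_sub hX, Real.rpow_two]
    have := (Real.rpow_pos_of_pos hX γ).ne'
    field_simp

theorem ThetaAtInfinity.exists_mul_rpow_le {f : ℝ → ℝ} {γ γ' : ℝ} (hγ : γ' ≤ γ)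
    (hf : ThetaAtInfinity f fun x => |x| ^ γ) :
    ∃ c : ℝ, 0 < c ∧ ∀ᶠ x in cocompact ℝ, c * |x| ^ γ' ≤ f x := by
  obtain ⟨C, hC, hlim⟩ := hf
  refine ⟨C / 2, by positivity, ?_⟩
  filter_upwards [eventually_cocompact_le_abs 1,
    hlim.eventually (lt_mem_nhds (show C / 2 < C by linarith))] with x hx h1
  have hX : 0 < |x| := by linarith
  rw [lt_div_iff₀ (by positivity)] at h1
  refine le_trans ?_ h1.le
  gcongr

end Main

end PDRWM

end

theorem lemma2
    (p Ginv : ℝ → ℝ) (h : ℝ) (hh : 0 < h)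
    (hp : Measurable p) (hG : Measurable Ginv)
    (hprob : IsProbabilityMeasure (PDRWM.target p))
    (hpc : PDRWM.BoundedAwayOnCompacts p)
    (hGc : PDRWM.BoundedAwayOnCompacts Ginv) :
    (PDRWM.LogConcaveInTails p →
      Ginv =o[cocompact ℝ] (fun x : ℝ => |x| ^ 2) →
      (∃ c : ℝ, 0 < c ∧ ∀ᶠ x in cocompact ℝ, c ≤ Ginv x) →
      PDRWM.NonOscillatingTails Ginv →
      PDRWM.GeometricallyErgodic (PDRWM.chain p Ginv h hp hG) (PDRWM.target p)) ∧
    (∀ β γ : ℝ, 0 < β → β < 1 → PDRWM.SubexponentialTails p β →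
      2 * (1 - β) < γ → γ < 2 →
      PDRWM.ThetaAtInfinity Ginv (fun x : ℝ => |x| ^ γ) →
      PDRWM.GeometricallyErgodic (PDRWM.chain p Ginv h hp hG) (PDRWM.target p)) := by
  constructor
  · rintro ⟨x₀, a, hx₀, ha, hr, hl⟩ ho hlow hosc
    -- For `β = 1` the growth condition has exponent `0` and reduces to a positive lower bound on
    -- `Ginv` in the tails.
    refine PDRWM.geometricallyErgodic_chain (β := 1) (s := a / 2) hh hp hG hpc hGc one_pos le_rfl
      (by positivity) hx₀ (PDRWM.tailDecay_of_two_sided hpc.pos (fun x y hx hxy => ?_)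
        (fun x y hx hxy => ?_)) hosc ho (by simpa using hlow)
    · rw [Real.rpow_one, Real.rpow_one, abs_of_pos (by linarith), abs_of_pos (by linarith)]
      exact hr x y hx hxy
    · rw [Real.rpow_one, Real.rpow_one]
      exact hl x y hx hxy
  · rintro β γ hβ0 hβ1 ⟨x₀, a, hx₀, ha, hr, hl⟩ hγ hγ2 hΘ
    refine PDRWM.geometricallyErgodic_chain (β := β) (s := a / 2) hh hp hG hpc hGc hβ0 hβ1.le
      (by positivity) hx₀ (PDRWM.tailDecay_of_two_sided hpc.pos (fun x y hx hxy => ?_) hl)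
      hΘ.nonOscillatingTails (hΘ.isLittleO_sq hγ2) (hΘ.exists_mul_rpow_le hγ.le)
    rw [abs_of_pos (by linarith : 0 < y), abs_of_pos (by linarith : 0 < x)]
    exact hr x y hx hxy
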